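/- Let $f:\mathbb{N}_0\to[0,\infty)$ and $\gamma\in(0,1)$ be such that $f(k)\le\gamma k+1$ for all $k\in\mathbb{N}_0$. Consider the preferential attachment model with random outdegree and attachment rule $f$: the graph $\mathcal{G}_1$ consists of vertex $1$ and no edges; given $\mathcal{G}_n$, vertex $n+1$ is added and, independently for each $j\in\{1,\dots,n\}$, a directed edge from $n+1$ to $j$ is inserted with probability $f(\deg_n^-(j))/n$, where $\deg_n^-(j)$ is the indegree of $j$ in $\mathcal{G}_n$. Let $D_n$ be the outdegree of vertex $n$, let $W_n$ be the indegree of a uniformly chosen vertex of $\mathcal{G}_n$, and for $n\ge2$ let $\lambda_n=\mathbb{E}[f(W_{n-1})]$. Write $d_{TV}(\mu,\nu)=\sup_A|\mu(A)-\nu(A)|$ for the total variation distance and $\mathrm{Po}(\lambda)$ for the Poisson distribution with parameter $\lambda$. (1) There exists $C>0$ such that for all $n\ge2$ $$d_{TV}(D_n,\mathrm{Po}(\lambda_n))\le C\cdot\begin{cases}\frac1{n+1},&0<\gamma<\frac12,\\ \frac{\log n}{n},&\gamma=\frac12,\\ n^{-2(1-\gamma)},&\frac12<\gamma<1.\end{cases}$$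 (2) The weights $\mu_k=\frac{1}{1+f(k)}\prod_{i=0}^{k-1}\frac{f(i)}{1+f(i)}$, $k\in\mathbb{N}_0$, define a probability distribution $\mu$ on $\mathbb{N}_0$; for $W\sim\mu$ the variable $f(W)$ is integrable, and $\lambda_n\to\mathbb{E}[f(W)]$ as $n\to\infty$. (3) If moreover $f(k)=\gamma k+\beta$ for all $k\in\mathbb{N}_0$, with some $\beta\in[0,1]$, then there exists $C>0$ such that for all $n\ge2$ $$|\lambda_n-\mathbb{E}[f(W)]|\le C\,n^{-1+\gamma}.$$ -/

import Mathlib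

open MeasureTheory ProbabilityTheory Filter Topology
open scoped ENNReal

namespace PrefAttach

/-- Total variation distance `sup_A |μ(A) - ν(A)|` over measurable sets `A`. -/
noncomputable def tvDist {E : Type*} [MeasurableSpace E] (μ ν : Measure E) : ℝ :=
  ⨆ A : {A : Set E // MeasurableSet A}, |μ.real A - ν.real A|

/-- The law of a random subset of the finite set `s` that contains each `k ∈ s` independently
with probability `p k`: the subset `t` has probability `∏_{k ∈ t} p k * ∏_{k ∈ s \ t} (1 - p k)`. -/
noncomputable def bernoulliSubset (s : Finset ℕ) (p : ℕ → ℝ≥0∞) (hp : ∀ k, p k ≤ 1) :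
    PMF (Finset ℕ) :=
  PMF.ofFinset
    (fun t => if t ⊆ s then (∏ k ∈ t, p k) * ∏ k ∈ s \ t, (1 - p k) else 0)
    s.powerset
    (by
      have h : ∑ t ∈ s.powerset, (∏ k ∈ t, p k) * ∏ k ∈ s \ t, (1 - p k) = 1 := by
        rw [← Finset.prod_add]
        exact Finset.prod_eq_one fun k _ => add_tsub_cancel_of_le (hp k)
      refine (Finset.sum_congr rfl fun t ht => ?_).trans h
      rw [if_pos (Finset.mem_powerset.mp ht)])
    (by
      intro t ht
      rw [if_neg (fun h => ht (Finset.mem_powerset.mpr h))])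

/-- A directed graph on vertices labelled `1, 2, …`, given by its finite set of edges;
`(i, j)` is an edge from `i` to `j`. -/
abbrev Graph : Type := Finset (ℕ × ℕ)

/-- The indegree of the vertex `j`. -/
def indeg (g : Graph) (j : ℕ) : ℕ := (g.filter fun e => e.2 = j).card

/-- The outdegree of the vertex `i`. -/
def outdeg (g : Graph) (i : ℕ) : ℕ := (g.filter fun e => e.1 = i).card

/-- The probability that vertex `n + 1` connects to `j`, given that the graph at time `n` is `g`:
it is `f (indeg g j) / n`. The truncation at `1` only makes the definition total: if
`f k ≤ k + 1` for all `k`, it is inactive, see `connectProb_eq`. -/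
noncomputable def connectProb (f : ℕ → ℝ) (n : ℕ) (g : Graph) (j : ℕ) : ℝ≥0∞ :=
  min 1 (ENNReal.ofReal (f (indeg g j) / n))

/-- One step of the dynamics: vertex `n + 1` is added to the graph `g` on `{1, …, n}` and sends
an edge to each `j ∈ {1, …, n}` independently with probability `f (indeg g j) / n`. -/
noncomputable def step (f : ℕ → ℝ) (n : ℕ) (g : Graph) : PMF Graph :=
  (bernoulliSubset (Finset.Icc 1 n) (connectProb f n g) (fun _ => min_le_left _ _)).map
    fun S => g ∪ S.image fun j => (n + 1, j)

/-- The law of the random graph at time `n ≥ 1` in the preferential attachment model with random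
outdegree and attachment rule `f`. At time `1` there is one vertex and no edge. (The value at time
`0` is irrelevant.) As the graph at time `n` determines the graphs at earlier times, this is also
the joint law of the first `n` graphs. -/
noncomputable def graphLaw (f : ℕ → ℝ) : ℕ → PMF Graph
  | 0 => PMF.pure ∅
  | 1 => PMF.pure ∅
  | n + 2 => (graphLaw f (n + 1)).bind (step f (n + 1))

/-- A uniformly chosen vertex of `{1, …, n}`, for `n ≥ 1`. (The value at `n = 0` is irrelevant.) -/
noncomputable def uniformVertex (n : ℕ) : PMF ℕ :=
  if h : (Finset.Icc 1 n).Nonempty then PMF.uniformOfFinset (Finset.Icc 1 n) h else PMF.pure 0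

/-- The law of `W_n`, the indegree of a uniformly chosen vertex at time `n ≥ 1`. -/
noncomputable def indegreeLaw (f : ℕ → ℝ) (n : ℕ) : PMF ℕ :=
  (graphLaw f n).bind fun g => (uniformVertex n).map (indeg g)

/-- The law of `D_n`, the outdegree of vertex `n` (upon its insertion, hence forever). -/
noncomputable def outdegreeLaw (f : ℕ → ℝ) (n : ℕ) : PMF ℕ :=
  (graphLaw f n).map fun g => outdeg g n

/-- `λ_n = E[f(W_{n-1})]`, for `n ≥ 2`. -/
noncomputable def lam (f : ℕ → ℝ) (n : ℕ) : ℝ :=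
  ∫ k, f k ∂(indegreeLaw f (n - 1)).toMeasure

/-- The weights `μ_k = 1 / (1 + f k) * ∏_{i < k} f i / (1 + f i)`. -/
noncomputable def limitWeight (f : ℕ → ℝ) (k : ℕ) : ℝ :=
  1 / (1 + f k) * ∏ i ∈ Finset.range k, f i / (1 + f i)

/-- The measure `μ` on `ℕ` with `μ {k} = μ_k`. -/
noncomputable def limitLaw (f : ℕ → ℝ) : Measure ℕ :=
  Measure.sum fun k => ENNReal.ofReal (limitWeight f k) • Measure.dirac k

/-- The rate `1 / (n + 1)`, `log n / n` or `n ^ (-2 (1 - γ))` as `γ < 1/2`, `γ = 1/2`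
or `γ > 1/2`. -/
noncomputable def outdegreeRate (γ : ℝ) (n : ℕ) : ℝ :=
  if γ < 1 / 2 then 1 / ((n : ℝ) + 1)
  else if γ = 1 / 2 then Real.log n / n
  else (n : ℝ) ^ (-2 * (1 - γ))

/-- Indegrees at time `n + 1` are at most `n`. -/
theorem indeg_le (f : ℕ → ℝ) (n : ℕ) :
    ∀ g ∈ (graphLaw f (n + 1)).support, ∀ j, indeg g j ≤ n := by
  induction n with
  | zero =>
    intro g hg j
    have h : g = ∅ := by simpa [graphLaw] using hg
    simp [h, indeg]
  | succ n ih =>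
    intro g hg j
    simp only [graphLaw, PMF.mem_support_bind_iff] at hg
    obtain ⟨g', hg', hg⟩ := hg
    simp only [step, PMF.support_map, Set.mem_image] at hg
    obtain ⟨S, -, rfl⟩ := hg
    have h1 := ih g' hg' j
    unfold indeg at h1 ⊢
    rw [Finset.filter_union]
    refine (Finset.card_union_le _ _).trans (Nat.add_le_add h1 ?_)
    refine Finset.card_le_one.mpr fun a ha b hb => ?_
    simp only [Finset.mem_filter, Finset.mem_image] at ha hb
    obtain ⟨⟨x, -, rfl⟩, hx⟩ := ha
    obtain ⟨⟨y, -, rfl⟩, hy⟩ := hb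
    simp_all

/-- If `f k ≤ k + 1` for all `k`, the truncation in `connectProb` is inactive. -/
theorem connectProb_eq (f : ℕ → ℝ) (hf : ∀ k : ℕ, f k ≤ k + 1) (n : ℕ) (g : Graph)
    (hg : g ∈ (graphLaw f (n + 1)).support) (j : ℕ) :
    connectProb f (n + 1) g j = ENNReal.ofReal (f (indeg g j) / ((n + 1 : ℕ) : ℝ)) := by
  refine min_eq_right (ENNReal.ofReal_le_one.mpr ?_)
  have h1 : ((indeg g j : ℕ) : ℝ) ≤ n := by exact_mod_cast indeg_le f n g hg j
  have h2 := hf (indeg g j)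
  rw [div_le_one (by positivity)]
  push_cast
  linarith

end PrefAttach

/-!
Each vertex `j` collects in-edges by itself: given the graph, the in-edge of `j` at the next step
depends on the indegree of `j` only, and the edges are inserted independently. Hence the indegrees
of distinct vertices are independent Markov chains (`expect_graphLaw_prod`, `expect_indeg_succ`).
Averaging the connection probabilities over the graph, one finds that the neighbours of vertex
`n + 1` form a Bernoulli subset of `{1, …, n}` with deterministic probabilities `p j`
(`bind_bernoulliSubset`), so `D_{n+1}` is exactly a sum of independent indicators, of total mean
`lam f (n + 1)`. Le Cam's inequality (`abs_real_map_card_sub_poisson_le`) bounds the distance to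
the Poisson law by `∑ p j ^ 2`. As `E[γ deg j + 1]` grows at most by the factor `1 + γ / n` in each
step, `p j ≤ 3 (n / j) ^ γ / n`, and summing the squares gives the three rates
(`exists_le_outdegreeRate`).

For the limit, `P(W_n = k)` satisfies
`(n + 1) P(W_{n+1} = k) = (n - f k) P(W_n = k) + f (k - 1) P(W_n = k - 1)` (with the last term
replaced by `1` for `k = 0`). Solved by induction on `k` with a stochastic approximation argument
(`tendsto_of_recursion`), it yields `P(W_n = k) → limitWeight f k`. Passing to the limit in
expectations needs uniform integrability: the function `testFun γ c`, of growth `k ^ (c / γ)` with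
`γ < c < 1`, has bounded expectation under all `W_n` (`indegMean_testFun_le`) and grows faster than
linearly. This shows at once that the weights sum to one, that `f` is integrable, and that
`lam f n` converges.

For `f k = γ k + β` the recursion for `lam f n` closes; the distance to its fixed point
`β / (1 - γ)` is multiplied by `1 - (1 - γ) / (n + 2)` from time `n + 2` to `n + 3`, and the fixed
point equals `E[f(W)]` because both are the limit of `lam f n`.
-/

namespace PrefAttach

/-! ### Expectations of nonnegative functions -/

/-- The expectation `∑ a, p a * F a` of a function with values in `[0, ∞]`. -/
noncomputable def expect {α : Type*} (p : PMF α) (F : α → ℝ≥0∞) : ℝ≥0∞ := ∑' a, p a * F a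

theorem expect_congr {α : Type*} {p : PMF α} {F G : α → ℝ≥0∞}
    (h : ∀ a ∈ p.support, F a = G a) : expect p F = expect p G := by
  refine tsum_congr fun a => ?_
  by_cases ha : p a = 0
  · simp [ha]
  · rw [h a ((PMF.mem_support_iff _ _).2 ha)]

theorem expect_const {α : Type*} (p : PMF α) (c : ℝ≥0∞) : expect p (fun _ => c) = c := by
  simp [expect, ENNReal.tsum_mul_right, p.tsum_coe]

theorem expect_pure {α : Type*} (a : α) (F : α → ℝ≥0∞) : expect (PMF.pure a) F = F a := by
  classical
  unfold expect
  rw [tsum_eq_single a]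
  · simp
  · intro b hb
    simp [PMF.pure_apply, hb]

theorem expect_bind {α β : Type*} (p : PMF α) (q : α → PMF β) (F : β → ℝ≥0∞) :
    expect (p.bind q) F = expect p (fun a => expect (q a) F) := by
  simp only [expect, PMF.bind_apply, ← ENNReal.tsum_mul_right, ← ENNReal.tsum_mul_left]
  rw [ENNReal.tsum_comm]
  simp only [mul_assoc]

theorem expect_map {α β : Type*} (p : PMF α) (g : α → β) (F : β → ℝ≥0∞) :
    expect (p.map g) F = expect p (fun a => F (g a)) := by
  rw [← PMF.bind_pure_comp, expect_bind]
  simp [expect_pure]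

theorem expect_add {α : Type*} (p : PMF α) (F G : α → ℝ≥0∞) :
    expect p (fun a => F a + G a) = expect p F + expect p G := by
  simp only [expect, mul_add, ENNReal.tsum_add]

theorem expect_const_mul {α : Type*} (p : PMF α) (c : ℝ≥0∞) (F : α → ℝ≥0∞) :
    expect p (fun a => c * F a) = c * expect p F := by
  simp only [expect, ← ENNReal.tsum_mul_left, mul_left_comm]

theorem expect_finsetSum {α ι : Type*} (p : PMF α) (s : Finset ι) (F : ι → α → ℝ≥0∞) :
    expect p (fun a => ∑ i ∈ s, F i a) = ∑ i ∈ s, expect p (F i) := by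
  simp only [expect, Finset.mul_sum]
  exact Summable.tsum_finsetSum fun _ _ => ENNReal.summable

theorem expect_mono {α : Type*} (p : PMF α) {F G : α → ℝ≥0∞} (h : ∀ a, F a ≤ G a) :
    expect p F ≤ expect p G :=
  ENNReal.tsum_le_tsum fun a => by gcongr; exact h a

theorem expect_le_one {α : Type*} (p : PMF α) {F : α → ℝ≥0∞} (h : ∀ a, F a ≤ 1) :
    expect p F ≤ 1 :=
  (expect_mono p h).trans_eq (expect_const p 1)

theorem expect_one_sub {α : Type*} (p : PMF α) {F : α → ℝ≥0∞} (h : ∀ a, F a ≤ 1) :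
    expect p (fun a => 1 - F a) = 1 - expect p F := by
  refine ENNReal.eq_sub_of_add_eq ((expect_le_one p h).trans_lt ENNReal.one_lt_top).ne ?_
  rw [← expect_add]
  simp only [tsub_add_cancel_of_le (h _), expect_const]

theorem apply_eq_expect {α : Type*} [DecidableEq α] (p : PMF α) (a : α) :
    p a = expect p (fun b => if b = a then 1 else 0) := by
  simp [expect]

/-- Under `bernoulliSubset`, the indicators of the events `k ∈ t` are independent. -/
theorem expect_bernoulliSubset_prod (s : Finset ℕ) (p : ℕ → ℝ≥0∞) (hp : ∀ k, p k ≤ 1)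
    (a b : ℕ → ℝ≥0∞) :
    expect (bernoulliSubset s p hp) (fun t => ∏ k ∈ s, if k ∈ t then b k else a k) =
      ∏ k ∈ s, ((1 - p k) * a k + p k * b k) := by
  unfold expect
  rw [tsum_eq_sum (s := s.powerset)]
  · simp_rw [add_comm ((1 - p _) * a _)]
    rw [Finset.prod_add]
    refine Finset.sum_congr rfl fun t ht => ?_
    have hts := Finset.mem_powerset.1 ht
    rw [bernoulliSubset, PMF.ofFinset_apply, if_pos hts, Finset.prod_mul_distrib,
      Finset.prod_mul_distrib, Finset.prod_ite, Finset.filter_mem_eq_inter,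
      Finset.inter_eq_right.2 hts, Finset.filter_notMem_eq_sdiff]
    ring
  · intro t ht
    rw [bernoulliSubset, PMF.ofFinset_apply_of_notMem _ _ ht, zero_mul]

theorem subset_of_mem_support_bernoulliSubset {s : Finset ℕ} {p : ℕ → ℝ≥0∞}
    {hp : ∀ k, p k ≤ 1} {t : Finset ℕ} (ht : t ∈ (bernoulliSubset s p hp).support) : t ⊆ s := by
  unfold bernoulliSubset at ht
  rw [PMF.mem_support_ofFinset_iff, Finset.mem_powerset] at ht
  exact ht.1

/-! ### One step of the dynamics -/

/-- In the graph at time `n + 1`, edges point from a vertex `≤ n + 1` to a vertex `≤ n`. -/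
theorem edge_le_of_mem_support (f : ℕ → ℝ) (n : ℕ) :
    ∀ g ∈ (graphLaw f (n + 1)).support, ∀ e ∈ g, e.1 ≤ n + 1 ∧ e.2 ≤ n := by
  induction n with
  | zero =>
    intro g hg e he
    have h : g = ∅ := by simpa [graphLaw] using hg
    simp [h] at he
  | succ n ih =>
    intro g hg e he
    simp only [graphLaw, PMF.mem_support_bind_iff] at hg
    obtain ⟨g', hg', hg⟩ := hg
    simp only [step, PMF.support_map, Set.mem_image] at hg
    obtain ⟨S, hS, rfl⟩ := hg
    have hS' := subset_of_mem_support_bernoulliSubset hS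
    rcases Finset.mem_union.1 he with he | he
    · have := ih g' hg' e he
      omega
    · obtain ⟨x, hx, rfl⟩ := Finset.mem_image.1 he
      have := Finset.mem_Icc.1 (hS' hx)
      simp only
      omega

theorem connectProb_le_one (f : ℕ → ℝ) (n : ℕ) (g : Graph) (j : ℕ) : connectProb f n g j ≤ 1 :=
  min_le_left _ _

theorem step_eq (f : ℕ → ℝ) (n : ℕ) (g : Graph) :
    step f n g = (bernoulliSubset (Finset.Icc 1 n) (connectProb f n g)
      (connectProb_le_one f n g)).map fun S => g ∪ S.image fun j => (n + 1, j) := rfl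

theorem indeg_last (f : ℕ → ℝ) (n : ℕ) (g : Graph) (hg : g ∈ (graphLaw f (n + 1)).support)
    (j : ℕ) (hj : n < j) : indeg g j = 0 := by
  rw [indeg, Finset.card_eq_zero, Finset.filter_eq_empty_iff]
  intro e he h
  have := (edge_le_of_mem_support f n g hg e he).2
  omega

theorem indeg_union_image (n : ℕ) (g : Graph) (hg : ∀ e ∈ g, e.1 ≤ n) (S : Finset ℕ) (j : ℕ) :
    indeg (g ∪ S.image fun k => (n + 1, k)) j = if j ∈ S then indeg g j + 1 else indeg g j := by
  unfold indeg
  rw [Finset.filter_union, Finset.card_union_of_disjoint]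
  · have h : (S.image fun k => (n + 1, k)).filter (fun e => e.2 = j) =
        if j ∈ S then {(n + 1, j)} else ∅ := by
      ext ⟨a, b⟩
      split_ifs <;> simp <;> grind
    rw [h]
    split_ifs <;> simp
  · rw [Finset.disjoint_left]
    intro e he he'
    obtain ⟨x, -, rfl⟩ := Finset.mem_image.1 (Finset.mem_filter.1 he').1
    have := hg _ (Finset.mem_filter.1 he).1
    simp at this

theorem outdeg_union_image (n : ℕ) (g : Graph) (hg : ∀ e ∈ g, e.1 ≤ n) (S : Finset ℕ) :
    outdeg (g ∪ S.image fun k => (n + 1, k)) (n + 1) = S.card := by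
  unfold outdeg
  have h1 : g.filter (fun e => e.1 = n + 1) = ∅ := by
    rw [Finset.filter_eq_empty_iff]
    intro e he h
    have := hg e he
    omega
  have h2 : (S.image fun k => (n + 1, k)).filter (fun e => e.1 = n + 1) =
      S.image fun k => (n + 1, k) := by
    rw [Finset.filter_eq_self]
    intro e he
    obtain ⟨x, -, rfl⟩ := Finset.mem_image.1 he
    rfl
  rw [Finset.filter_union, h1, h2, Finset.empty_union, Finset.card_image_of_injective]
  intro a b h
  simpa using h

/-- The transition operator of the indegree of a fixed vertex: at time `n` the indegree `d`
increases by one with probability `f d / n` (truncated at `1`, as in `connectProb`). -/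
noncomputable def attachOp (f : ℕ → ℝ) (n : ℕ) (h : ℕ → ℝ≥0∞) (d : ℕ) : ℝ≥0∞ :=
  (1 - min 1 (ENNReal.ofReal (f d / n))) * h d + min 1 (ENNReal.ofReal (f d / n)) * h (d + 1)

theorem attachOp_one (f : ℕ → ℝ) (n : ℕ) (d : ℕ) : attachOp f n (fun _ => 1) d = 1 := by
  simp only [attachOp, mul_one]
  exact tsub_add_cancel_of_le (min_le_left _ _)

theorem expect_step_prod (f : ℕ → ℝ) (n : ℕ) (g : Graph)
    (hg : g ∈ (graphLaw f (n + 1)).support) (h : ℕ → ℕ → ℝ≥0∞) :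
    expect (step f (n + 1) g) (fun g' => ∏ j ∈ Finset.Icc 1 (n + 2), h j (indeg g' j)) =
      (∏ j ∈ Finset.Icc 1 (n + 1), attachOp f (n + 1) (h j) (indeg g j)) * h (n + 2) 0 := by
  have hg1 : ∀ e ∈ g, e.1 ≤ n + 1 := fun e he => (edge_le_of_mem_support f n g hg e he).1
  rw [step_eq, expect_map]
  have key : ∀ S ∈ (bernoulliSubset (Finset.Icc 1 (n + 1)) (connectProb f (n + 1) g)
      (connectProb_le_one f (n + 1) g)).support,
      (∏ j ∈ Finset.Icc 1 (n + 2), h j (indeg (g ∪ S.image fun k => (n + 1 + 1, k)) j)) =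
      h (n + 2) 0 * ∏ j ∈ Finset.Icc 1 (n + 1),
        if j ∈ S then h j (indeg g j + 1) else h j (indeg g j) := by
    intro S hS
    have hS' := subset_of_mem_support_bernoulliSubset hS
    have hlast : n + 2 ∉ S := fun hmem => by
      have := Finset.mem_Icc.1 (hS' hmem)
      omega
    rw [Finset.prod_Icc_succ_top (by omega), mul_comm]
    simp only [indeg_union_image (n + 1) g hg1]
    rw [if_neg hlast, indeg_last f n g hg (n + 2) (by omega)]
    congr 1
    refine Finset.prod_congr rfl fun j _ => ?_
    split_ifs <;> rfl
  rw [expect_congr key, expect_const_mul, expect_bernoulliSubset_prod, mul_comm]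
  rfl

theorem expect_graphLaw_succ_prod (f : ℕ → ℝ) (n : ℕ) (h : ℕ → ℕ → ℝ≥0∞) :
    expect (graphLaw f (n + 2)) (fun g => ∏ j ∈ Finset.Icc 1 (n + 2), h j (indeg g j)) =
      expect (graphLaw f (n + 1))
        (fun g => ∏ j ∈ Finset.Icc 1 (n + 1), attachOp f (n + 1) (h j) (indeg g j)) *
        h (n + 2) 0 := by
  rw [graphLaw, expect_bind, expect_congr fun g hg => expect_step_prod f n g hg h, mul_comm,
    ← expect_const_mul]
  simp only [mul_comm]

/-- The indegree of the vertex `j` is a Markov chain on its own. -/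
theorem expect_indeg_succ (f : ℕ → ℝ) (n j : ℕ) (hj : j ∈ Finset.Icc 1 (n + 1))
    (h : ℕ → ℝ≥0∞) :
    expect (graphLaw f (n + 2)) (fun g => h (indeg g j)) =
      expect (graphLaw f (n + 1)) (fun g => attachOp f (n + 1) h (indeg g j)) := by
  have hj' := Finset.mem_Icc.1 hj
  have key := expect_graphLaw_succ_prod f n fun i => if i = j then h else fun _ => 1
  have h1 : ∀ g : Graph, (∏ i ∈ Finset.Icc 1 (n + 2), (if i = j then h else fun _ => 1)
      (indeg g i)) = h (indeg g j) := by
    intro g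
    rw [Finset.prod_eq_single j]
    · simp
    · intro i _ hi
      simp [hi]
    · intro hj2
      exact absurd (Finset.mem_Icc.2 ⟨hj'.1, by omega⟩) hj2
  have h2 : ∀ g : Graph, (∏ i ∈ Finset.Icc 1 (n + 1), attachOp f (n + 1)
      (if i = j then h else fun _ => 1) (indeg g i)) = attachOp f (n + 1) h (indeg g j) := by
    intro g
    rw [Finset.prod_eq_single j]
    · simp
    · intro i _ hi
      simp [hi, attachOp_one]
    · exact fun hj2 => absurd hj hj2
  simp only [h1, h2] at key
  rw [key, if_neg (by omega), mul_one]

theorem expect_indeg_last (f : ℕ → ℝ) (n : ℕ) (h : ℕ → ℝ≥0∞) :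
    expect (graphLaw f (n + 1)) (fun g => h (indeg g (n + 1))) = h 0 := by
  rw [expect_congr (G := fun _ => h 0), expect_const]
  intro g hg
  rw [indeg_last f n g hg (n + 1) (by omega)]

/-- The indegrees of the vertices `1, …, n + 1` at time `n + 1` are independent. -/
theorem expect_graphLaw_prod (f : ℕ → ℝ) (n : ℕ) (h : ℕ → ℕ → ℝ≥0∞) :
    expect (graphLaw f (n + 1)) (fun g => ∏ j ∈ Finset.Icc 1 (n + 1), h j (indeg g j)) =
      ∏ j ∈ Finset.Icc 1 (n + 1), expect (graphLaw f (n + 1)) (fun g => h j (indeg g j)) := by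
  induction n generalizing h with
  | zero => simp
  | succ n ih =>
    rw [expect_graphLaw_succ_prod, ih, Finset.prod_Icc_succ_top (by omega) (f := fun j =>
      expect (graphLaw f (n + 2)) (fun g => h j (indeg g j))), expect_indeg_last f (n + 1)]
    congr 1
    exact Finset.prod_congr rfl fun j hj => (expect_indeg_succ f n j hj (h j)).symm

/-! ### The law of the outdegree -/

/-- The probability that vertex `n + 1` connects to `j`, averaged over the graph at time `n`. -/
noncomputable def edgeProb (f : ℕ → ℝ) (n j : ℕ) : ℝ≥0∞ :=
  expect (graphLaw f n) (fun g => connectProb f n g j)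

theorem edgeProb_le_one (f : ℕ → ℝ) (n j : ℕ) : edgeProb f n j ≤ 1 :=
  expect_le_one _ fun g => connectProb_le_one f n g j

/-- Averaging over the graph, vertex `n + 2` still chooses its neighbours independently. -/
theorem bind_bernoulliSubset (f : ℕ → ℝ) (n : ℕ) :
    ((graphLaw f (n + 1)).bind fun g => bernoulliSubset (Finset.Icc 1 (n + 1))
      (connectProb f (n + 1) g) (connectProb_le_one f (n + 1) g)) =
    bernoulliSubset (Finset.Icc 1 (n + 1)) (edgeProb f (n + 1)) (edgeProb_le_one f (n + 1)) := by
  ext t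
  rw [PMF.bind_apply]
  simp only [bernoulliSubset, PMF.ofFinset_apply]
  by_cases ht : t ⊆ Finset.Icc 1 (n + 1)
  · simp only [if_pos ht]
    have h1 : ∀ q : ℕ → ℝ≥0∞, (∏ k ∈ t, q k) * ∏ k ∈ Finset.Icc 1 (n + 1) \ t, (1 - q k) =
        ∏ k ∈ Finset.Icc 1 (n + 1), if k ∈ t then q k else 1 - q k := by
      intro q
      rw [Finset.prod_ite, Finset.filter_mem_eq_inter, Finset.inter_eq_right.2 ht,
        Finset.filter_notMem_eq_sdiff]
    have h2 := expect_graphLaw_prod f n fun k d =>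
      if k ∈ t then min 1 (ENNReal.ofReal (f d / (n + 1 : ℕ)))
      else 1 - min 1 (ENNReal.ofReal (f d / (n + 1 : ℕ)))
    simp only [h1]
    refine h2.trans (Finset.prod_congr rfl fun k _ => ?_)
    split_ifs
    · rfl
    · exact expect_one_sub _ fun _ => min_le_left _ _
  · simp [if_neg ht]

theorem outdegreeLaw_eq (f : ℕ → ℝ) (n : ℕ) :
    outdegreeLaw f (n + 2) = (bernoulliSubset (Finset.Icc 1 (n + 1)) (edgeProb f (n + 1))
      (edgeProb_le_one f (n + 1))).map Finset.card := by
  rw [← bind_bernoulliSubset, outdegreeLaw, graphLaw, PMF.map_bind, PMF.map_bind]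
  ext k
  refine expect_congr fun g hg => ?_
  beta_reduce
  rw [step_eq, PMF.map_comp]
  congr 2
  funext S
  exact outdeg_union_image (n + 1) g (fun e he => (edge_le_of_mem_support f n g hg e he).1) S

/-! ### Poisson approximation of a sum of independent indicators -/

theorem expect_bernoulliSubset_eq_sum (s : Finset ℕ) (p : ℕ → ℝ≥0∞) (hp : ∀ k, p k ≤ 1)
    (F : Finset ℕ → ℝ≥0∞) :
    expect (bernoulliSubset s p hp) F =
      ∑ t ∈ s.powerset, ((∏ k ∈ t, p k) * ∏ k ∈ s \ t, (1 - p k)) * F t := by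
  unfold expect
  rw [tsum_eq_sum (s := s.powerset)]
  · refine Finset.sum_congr rfl fun t ht => ?_
    rw [bernoulliSubset, PMF.ofFinset_apply, if_pos (Finset.mem_powerset.1 ht)]
  · intro t ht
    rw [bernoulliSubset, PMF.ofFinset_apply_of_notMem _ _ ht, zero_mul]

theorem expect_bernoulliSubset_insert {s : Finset ℕ} {a : ℕ} (ha : a ∉ s) (p : ℕ → ℝ≥0∞)
    (hp : ∀ k, p k ≤ 1) (F : Finset ℕ → ℝ≥0∞) :
    expect (bernoulliSubset (insert a s) p hp) F =
      (1 - p a) * expect (bernoulliSubset s p hp) F +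
        p a * expect (bernoulliSubset s p hp) (fun t => F (insert a t)) := by
  simp only [expect_bernoulliSubset_eq_sum, Finset.sum_powerset_insert ha, Finset.mul_sum]
  congr 1
  · refine Finset.sum_congr rfl fun t ht => ?_
    have hat : a ∉ t := fun h => ha (Finset.mem_powerset.1 ht h)
    rw [Finset.insert_sdiff_of_notMem _ hat, Finset.prod_insert (by simp [ha])]
    ring
  · refine Finset.sum_congr rfl fun t ht => ?_
    have hat : a ∉ t := fun h => ha (Finset.mem_powerset.1 ht h)
    rw [Finset.insert_sdiff_insert, Finset.sdiff_insert_of_notMem ha, Finset.prod_insert hat]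
    ring

theorem toMeasure_map_card_eq_expect (q : PMF (Finset ℕ)) (A : Set ℕ) :
    (q.map Finset.card).toMeasure A = expect q (fun t => A.indicator (fun _ => 1) t.card) := by
  rw [PMF.toMeasure_apply_eq_tsum, ← expect_map q Finset.card (A.indicator fun _ => 1)]
  refine tsum_congr fun k => ?_
  by_cases hk : k ∈ A <;> simp [hk]

theorem real_map_card_bernoulliSubset_insert {s : Finset ℕ} {a : ℕ} (ha : a ∉ s)
    (p : ℕ → ℝ≥0∞) (hp : ∀ k, p k ≤ 1) (A : Set ℕ) :
    ((bernoulliSubset (insert a s) p hp).map Finset.card).toMeasure.real A =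
      (1 - (p a).toReal) * ((bernoulliSubset s p hp).map Finset.card).toMeasure.real A +
        (p a).toReal *
          ((bernoulliSubset s p hp).map Finset.card).toMeasure.real ((1 + ·) ⁻¹' A) := by
  have hpa : p a ≠ ∞ := ((hp a).trans_lt ENNReal.one_lt_top).ne
  have h : ((bernoulliSubset (insert a s) p hp).map Finset.card).toMeasure A =
      (1 - p a) * ((bernoulliSubset s p hp).map Finset.card).toMeasure A +
        p a * ((bernoulliSubset s p hp).map Finset.card).toMeasure ((1 + ·) ⁻¹' A) := by
    simp only [toMeasure_map_card_eq_expect]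
    rw [expect_bernoulliSubset_insert ha]
    congr 2
    refine expect_congr fun t ht => ?_
    have hat : a ∉ t := fun h => ha (subset_of_mem_support_bernoulliSubset ht h)
    rw [Finset.card_insert_of_notMem hat, add_comm]
    rfl
  simp only [measureReal_def]
  rw [h, ENNReal.toReal_add, ENNReal.toReal_mul, ENNReal.toReal_mul,
    ENNReal.toReal_sub_of_le (hp a) ENNReal.one_ne_top, ENNReal.toReal_one]
  · exact ENNReal.mul_ne_top (ENNReal.sub_ne_top ENNReal.one_ne_top) (measure_ne_top _ _)
  · exact ENNReal.mul_ne_top hpa (measure_ne_top _ _)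

theorem poissonMeasure_add_real (r s : NNReal) (A : Set ℕ) :
    (poissonMeasure (r + s)).real A =
      ∑' k, Real.exp (-r) * r ^ k / k.factorial * (poissonMeasure s).real ((k + ·) ⁻¹' A) := by
  have h1 : (poissonMeasure (r + s)) A =
      ∫⁻ k, (poissonMeasure s) ((k + ·) ⁻¹' A) ∂(poissonMeasure r) := by
    rw [← poissonMeasure_conv_poissonMeasure, Measure.conv,
      Measure.map_apply (by fun_prop) (MeasurableSet.of_discrete), Measure.prod_apply
      (MeasurableSet.of_discrete)]
    rfl
  have h2 := integral_poissonMeasure r fun k => (poissonMeasure s).real ((k + ·) ⁻¹' A)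
  simp only [smul_eq_mul] at h2
  rw [← h2, integral_eq_lintegral_of_nonneg_ae (ae_of_all _ fun k => measureReal_nonneg)
    Measurable.of_discrete.aestronglyMeasurable, measureReal_def, h1]
  simp

/-- A Bernoulli and a Poisson variable of the same mean `p` are at distance at most `p ^ 2`. -/
theorem abs_bernoulli_sub_poisson_le (p : NNReal) (x : ℕ → ℝ) (h0 : ∀ k, 0 ≤ x k)
    (h1 : ∀ k, x k ≤ 1) :
    |(1 - (p : ℝ)) * x 0 + p * x 1 - ∑' k, Real.exp (-p) * p ^ k / k.factorial * x k| ≤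
      (p : ℝ) ^ 2 := by
  have hp : (0 : ℝ) ≤ p := p.2
  have hw := hasSum_one_poissonMeasure p
  have hwx : Summable fun k : ℕ => Real.exp (-p) * (p : ℝ) ^ k / k.factorial * x k :=
    Summable.of_nonneg_of_le (fun k => mul_nonneg (by positivity) (h0 k))
      (fun k => mul_le_of_le_one_right (by positivity) (h1 k)) hw.summable
  have e1 := hw.summable.sum_add_tsum_nat_add 2
  have e2 := hwx.sum_add_tsum_nat_add 2
  have e3 : ∑' k : ℕ, Real.exp (-p) * (p : ℝ) ^ (k + 2) / (k + 2).factorial * x (k + 2) ≤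
      ∑' k : ℕ, Real.exp (-p) * (p : ℝ) ^ (k + 2) / (k + 2).factorial :=
    ((summable_nat_add_iff 2).2 hwx).tsum_le_tsum
      (fun k => mul_le_of_le_one_right (by positivity) (h1 _)) ((summable_nat_add_iff 2).2 hw.summable)
  have e4 : 0 ≤ ∑' k : ℕ, Real.exp (-p) * (p : ℝ) ^ (k + 2) / (k + 2).factorial * x (k + 2) :=
    tsum_nonneg fun k => mul_nonneg (by positivity) (h0 _)
  rw [hw.tsum_eq] at e1
  simp only [Finset.sum_range_succ, Finset.range_zero, Finset.sum_empty, pow_zero, pow_one,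
    Nat.factorial_zero, Nat.factorial_one, Nat.cast_one, div_one, mul_one, zero_add] at e1 e2
  have he := Real.one_sub_le_exp_neg (p : ℝ)
  have he1 : Real.exp (-(p : ℝ)) ≤ 1 := Real.exp_le_one_iff.2 (by linarith)
  have := h0 0
  have := h0 1
  have := h1 0
  have := h1 1
  -- The gap is at most `p * (1 - exp (-p))`, in both directions.
  have hpe : p * (1 - Real.exp (-(p : ℝ))) ≤ (p : ℝ) ^ 2 := by nlinarith
  have hx1 : p * (1 - Real.exp (-(p : ℝ))) * x 1 ≤ p * (1 - Real.exp (-(p : ℝ))) :=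
    mul_le_of_le_one_right (mul_nonneg hp (by linarith)) (h1 1)
  have hx1' : 0 ≤ p * (1 - Real.exp (-(p : ℝ))) * x 1 :=
    mul_nonneg (mul_nonneg hp (by linarith)) (h0 1)
  have hx0 : (Real.exp (-(p : ℝ)) - (1 - p)) * x 0 ≤ Real.exp (-(p : ℝ)) - (1 - p) :=
    mul_le_of_le_one_right (by linarith) (h1 0)
  have hx0' : 0 ≤ (Real.exp (-(p : ℝ)) - (1 - p)) * x 0 := mul_nonneg (by linarith) (h0 0)
  rw [abs_le]
  constructor <;> nlinarith

/-- Le Cam's inequality: a sum of independent indicators with success probabilities `p k` is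
within `∑ p k ^ 2` of the Poisson law of the same mean. -/
theorem abs_real_map_card_sub_poisson_le (s : Finset ℕ) (p : ℕ → ℝ≥0∞) (hp : ∀ k, p k ≤ 1)
    (A : Set ℕ) :
    |((bernoulliSubset s p hp).map Finset.card).toMeasure.real A -
      (poissonMeasure (∑ k ∈ s, (p k).toNNReal)).real A| ≤ ∑ k ∈ s, (p k).toReal ^ 2 := by
  induction s using Finset.induction_on generalizing A with
  | empty =>
    have h1 : ((bernoulliSubset ∅ p hp).map Finset.card).toMeasure A =
        A.indicator (fun _ => 1) 0 := by
      simp [toMeasure_map_card_eq_expect, expect_bernoulliSubset_eq_sum]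
    have h2 : poissonMeasure 0 = Measure.dirac 0 := by
      refine Measure.ext_of_singleton fun k => ?_
      rw [poissonMeasure_singleton]
      rcases k with - | k <;> simp
    simp only [Finset.sum_empty, h2, measureReal_def, h1]
    simp [Pi.one_def]
  | insert a s ha ih =>
    rw [Finset.sum_insert ha, Finset.sum_insert ha, poissonMeasure_add_real,
      real_map_card_bernoulliSubset_insert ha]
    have hpa : ((p a).toNNReal : ℝ) = (p a).toReal := rfl
    have key := abs_bernoulli_sub_poisson_le (p a).toNNReal (fun k => (poissonMeasure
      (∑ k ∈ s, (p k).toNNReal)).real ((k + ·) ⁻¹' A)) (fun k => measureReal_nonneg)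
      (fun k => measureReal_le_one)
    have i0 := ih ((0 + ·) ⁻¹' A)
    have i1 := ih ((1 + ·) ⁻¹' A)
    have hA : (0 + ·) ⁻¹' A = A := by ext; simp
    have q0 : 0 ≤ (p a).toReal := ENNReal.toReal_nonneg
    have q1 : (p a).toReal ≤ 1 := ENNReal.toReal_le_of_le_ofReal zero_le_one (by simpa using hp a)
    simp only [hA, hpa] at key i0 ⊢
    rw [abs_le] at key i0 i1 ⊢
    have j0 := mul_le_mul_of_nonneg_left i0.1 (sub_nonneg.2 q1)
    have j0' := mul_le_mul_of_nonneg_left i0.2 (sub_nonneg.2 q1)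
    have j1 := mul_le_mul_of_nonneg_left i1.1 q0
    have j1' := mul_le_mul_of_nonneg_left i1.2 q0
    constructor <;> linarith

/-! ### The indegree of a fixed vertex -/

/-- The probability that vertex `j` has indegree `k` at time `n`. -/
noncomputable def degProb (f : ℕ → ℝ) (n j k : ℕ) : ℝ :=
  (expect (graphLaw f n) (fun g => if indeg g j = k then 1 else 0)).toReal

/-- The expectation of `h` of the indegree of vertex `j` at time `n`. The sum is over all
possible values, as indegrees are less than `n`. -/
noncomputable def degMean (f : ℕ → ℝ) (n j : ℕ) (h : ℕ → ℝ) : ℝ :=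
  ∑ k ∈ Finset.range n, degProb f n j k * h k

theorem expect_ne_top_of_le_one {α : Type*} (p : PMF α) {F : α → ℝ≥0∞} (h : ∀ a, F a ≤ 1) :
    expect p F ≠ ∞ :=
  ((expect_le_one p h).trans_lt ENNReal.one_lt_top).ne

theorem expect_indicator_ne_top (f : ℕ → ℝ) (n j k : ℕ) :
    expect (graphLaw f n) (fun g => if indeg g j = k then 1 else 0) ≠ ∞ :=
  expect_ne_top_of_le_one _ fun g => by split_ifs <;> simp

theorem degProb_nonneg (f : ℕ → ℝ) (n j k : ℕ) : 0 ≤ degProb f n j k := ENNReal.toReal_nonneg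

theorem degProb_eq_zero (f : ℕ → ℝ) (n j k : ℕ) (hk : n < k) : degProb f (n + 1) j k = 0 := by
  rw [degProb, expect_congr (G := fun _ => 0), expect_const, ENNReal.toReal_zero]
  intro g hg
  have := indeg_le f n g hg j
  rw [if_neg (by omega)]

theorem degProb_last (f : ℕ → ℝ) (n k : ℕ) :
    degProb f (n + 1) (n + 1) k = if k = 0 then 1 else 0 := by
  rw [degProb, expect_indeg_last f n fun d => if d = k then 1 else 0]
  simp only [eq_comm (a := 0)]
  split_ifs <;> simp

/-- On the possible values of the indegree, the truncation of the connection probability is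
inactive. -/
theorem toReal_min_mul_degProb {f : ℕ → ℝ} (hf0 : ∀ k, 0 ≤ f k) (hf : ∀ k : ℕ, f k ≤ k + 1)
    (n j k : ℕ) :
    (min 1 (ENNReal.ofReal (f k / (n + 1 : ℕ)))).toReal * degProb f (n + 1) j k =
      f k / (n + 1) * degProb f (n + 1) j k := by
  rcases lt_or_ge n k with hk | hk
  · simp [degProb_eq_zero f n j k hk]
  · rw [min_eq_right, ENNReal.toReal_ofReal (div_nonneg (hf0 k) (by positivity))]
    · push_cast; rfl
    · rw [ENNReal.ofReal_le_one, div_le_one (by positivity)]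
      have : (k : ℝ) ≤ n := by exact_mod_cast hk
      have := hf k
      push_cast
      linarith

theorem toReal_one_sub_min (x : ℝ≥0∞) : (1 - min 1 x).toReal = 1 - (min 1 x).toReal := by
  rw [ENNReal.toReal_sub_of_le (min_le_left _ _) ENNReal.one_ne_top, ENNReal.toReal_one]

theorem degProb_succ_zero {f : ℕ → ℝ} (hf0 : ∀ k, 0 ≤ f k) (hf : ∀ k : ℕ, f k ≤ k + 1)
    (n j : ℕ) (hj : j ∈ Finset.Icc 1 (n + 1)) :
    degProb f (n + 2) j 0 = (1 - f 0 / (n + 1)) * degProb f (n + 1) j 0 := by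
  have h : ∀ d, attachOp f (n + 1) (fun d => if d = 0 then 1 else 0) d =
      (1 - min 1 (ENNReal.ofReal (f 0 / (n + 1 : ℕ)))) * if d = 0 then 1 else 0 := by
    intro d
    by_cases hd : d = 0
    · subst hd; simp [attachOp]
    · simp [attachOp, hd]
  rw [degProb, expect_indeg_succ f n j hj fun d => if d = 0 then 1 else 0]
  simp only [h]
  rw [expect_const_mul, ENNReal.toReal_mul, ← degProb, toReal_one_sub_min, sub_mul, sub_mul,
    toReal_min_mul_degProb hf0 hf]

theorem degProb_succ_succ {f : ℕ → ℝ} (hf0 : ∀ k, 0 ≤ f k) (hf : ∀ k : ℕ, f k ≤ k + 1)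
    (n j k : ℕ) (hj : j ∈ Finset.Icc 1 (n + 1)) :
    degProb f (n + 2) j (k + 1) = (1 - f (k + 1) / (n + 1)) * degProb f (n + 1) j (k + 1) +
      f k / (n + 1) * degProb f (n + 1) j k := by
  have h : ∀ d, attachOp f (n + 1) (fun d => if d = k + 1 then 1 else 0) d =
      (1 - min 1 (ENNReal.ofReal (f (k + 1) / (n + 1 : ℕ)))) * (if d = k + 1 then 1 else 0) +
      min 1 (ENNReal.ofReal (f k / (n + 1 : ℕ))) * (if d = k then 1 else 0) := by
    intro d
    unfold attachOp
    congr 1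
    · by_cases hd : d = k + 1
      · subst hd; simp
      · simp [hd]
    · by_cases hd : d = k
      · subst hd; simp
      · simp [hd]
  have hmin : ∀ x : ℝ≥0∞, min 1 x ≠ ∞ := fun x =>
    ((min_le_left _ _).trans_lt ENNReal.one_lt_top).ne
  rw [degProb, expect_indeg_succ f n j hj fun d => if d = k + 1 then 1 else 0]
  simp only [h]
  rw [expect_add, expect_const_mul, expect_const_mul, ENNReal.toReal_add, ENNReal.toReal_mul,
    ENNReal.toReal_mul, ← degProb, ← degProb, toReal_one_sub_min, sub_mul, sub_mul,
    toReal_min_mul_degProb hf0 hf, toReal_min_mul_degProb hf0 hf]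
  · exact ENNReal.mul_ne_top (ENNReal.sub_ne_top ENNReal.one_ne_top)
      (expect_indicator_ne_top f _ j _)
  · exact ENNReal.mul_ne_top (hmin _) (expect_indicator_ne_top f _ j _)

theorem degMean_last (f : ℕ → ℝ) (n : ℕ) (h : ℕ → ℝ) : degMean f (n + 1) (n + 1) h = h 0 := by
  simp [degMean, degProb_last]

theorem degMean_succ {f : ℕ → ℝ} (hf0 : ∀ k, 0 ≤ f k) (hf : ∀ k : ℕ, f k ≤ k + 1)
    (n j : ℕ) (hj : j ∈ Finset.Icc 1 (n + 1)) (h : ℕ → ℝ) :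
    degMean f (n + 2) j h = degMean f (n + 1) j h +
      degMean f (n + 1) j (fun k => f k * (h (k + 1) - h k)) / (n + 1) := by
  have e1 : degMean f (n + 2) j h =
      ∑ k ∈ Finset.range (n + 2), (1 - f k / (n + 1)) * degProb f (n + 1) j k * h k +
      ∑ k ∈ Finset.range (n + 1), f k / (n + 1) * degProb f (n + 1) j k * h (k + 1) := by
    rw [degMean, Finset.sum_range_succ', degProb_succ_zero hf0 hf n j hj,
      Finset.sum_range_succ' _ (n + 1), add_right_comm, ← Finset.sum_add_distrib]
    congr 1
    refine Finset.sum_congr rfl fun k _ => ?_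
    rw [degProb_succ_succ hf0 hf n j k hj]
    ring
  rw [e1, Finset.sum_range_succ, degProb_eq_zero f n j (n + 1) (by omega), degMean, degMean,
    Finset.sum_div, mul_zero, zero_mul, add_zero, ← Finset.sum_add_distrib,
    ← Finset.sum_add_distrib]
  refine Finset.sum_congr rfl fun k _ => ?_
  ring

theorem degMean_mono {f : ℕ → ℝ} (n j : ℕ) {h h' : ℕ → ℝ} (hh : ∀ k, h k ≤ h' k) :
    degMean f n j h ≤ degMean f n j h' :=
  Finset.sum_le_sum fun k _ => mul_le_mul_of_nonneg_left (hh k) (degProb_nonneg f n j k)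

theorem degMean_const_mul (f : ℕ → ℝ) (n j : ℕ) (c : ℝ) (h : ℕ → ℝ) :
    degMean f n j (fun k => c * h k) = c * degMean f n j h := by
  rw [degMean, degMean, Finset.mul_sum]
  exact Finset.sum_congr rfl fun k _ => by ring

theorem degMean_nonneg {f : ℕ → ℝ} (n j : ℕ) {h : ℕ → ℝ} (hh : ∀ k, 0 ≤ h k) :
    0 ≤ degMean f n j h :=
  Finset.sum_nonneg fun k _ => mul_nonneg (degProb_nonneg f n j k) (hh k)

theorem toReal_edgeProb {f : ℕ → ℝ} (hf0 : ∀ k, 0 ≤ f k) (hf : ∀ k : ℕ, f k ≤ k + 1)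
    (n j : ℕ) : (edgeProb f (n + 1) j).toReal = degMean f (n + 1) j f / (n + 1) := by
  have h : ∀ g ∈ (graphLaw f (n + 1)).support, connectProb f (n + 1) g j =
      ∑ k ∈ Finset.range (n + 1), min 1 (ENNReal.ofReal (f k / (n + 1 : ℕ))) *
        if indeg g j = k then 1 else 0 := by
    intro g hg
    have := indeg_le f n g hg j
    rw [Finset.sum_eq_single (indeg g j)]
    · simp [connectProb]
    · intro k _ hk
      simp [hk.symm]
    · intro hk
      exact absurd (Finset.mem_range.2 (by omega)) hk
  rw [edgeProb, expect_congr h, expect_finsetSum, ENNReal.toReal_sum, degMean, Finset.sum_div]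
  · refine Finset.sum_congr rfl fun k _ => ?_
    rw [expect_const_mul, ENNReal.toReal_mul, ← degProb, toReal_min_mul_degProb hf0 hf]
    ring
  · intro k _
    rw [expect_const_mul]
    exact ENNReal.mul_ne_top ((min_le_left _ _).trans_lt ENNReal.one_lt_top).ne
      (expect_indicator_ne_top f _ j _)

/-! ### The indegree of a uniformly chosen vertex -/

/-- The probability that `W_n` equals `k`. -/
noncomputable def indegProb (f : ℕ → ℝ) (n k : ℕ) : ℝ := (indegreeLaw f n k).toReal

/-- The expectation of `h (W_n)`; as `W_n < n`, the sum is over all possible values. -/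
noncomputable def indegMean (f : ℕ → ℝ) (n : ℕ) (h : ℕ → ℝ) : ℝ :=
  ∑ k ∈ Finset.range n, indegProb f n k * h k

theorem indegProb_eq (f : ℕ → ℝ) (n k : ℕ) :
    indegProb f (n + 1) k = (∑ j ∈ Finset.Icc 1 (n + 1), degProb f (n + 1) j k) / (n + 1) := by
  have hne : (Finset.Icc 1 (n + 1)).Nonempty := ⟨1, by simp⟩
  have hu : ∀ F : ℕ → ℝ≥0∞, expect (uniformVertex (n + 1)) F =
      ((n + 1 : ℕ) : ℝ≥0∞)⁻¹ * ∑ j ∈ Finset.Icc 1 (n + 1), F j := by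
    intro F
    rw [expect, uniformVertex, dif_pos hne, tsum_eq_sum (s := Finset.Icc 1 (n + 1)),
      Finset.mul_sum]
    · refine Finset.sum_congr rfl fun j hj => ?_
      rw [PMF.uniformOfFinset_apply_of_mem hne hj, Nat.card_Icc]
      simp
    · intro j hj
      rw [PMF.uniformOfFinset_apply_of_notMem hne hj, zero_mul]
  rw [indegProb, apply_eq_expect, indegreeLaw, expect_bind]
  simp only [expect_map, hu]
  rw [expect_const_mul, expect_finsetSum, ENNReal.toReal_mul, ENNReal.toReal_sum]
  · change _ * ∑ j ∈ Finset.Icc 1 (n + 1), degProb f (n + 1) j k = _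
    rw [ENNReal.toReal_inv, ENNReal.toReal_natCast]
    push_cast
    field_simp
  · intro j _
    exact expect_indicator_ne_top f _ j _

theorem indegProb_nonneg (f : ℕ → ℝ) (n k : ℕ) : 0 ≤ indegProb f n k := ENNReal.toReal_nonneg

theorem indegProb_eq_zero (f : ℕ → ℝ) (n k : ℕ) (hk : n < k) : indegProb f (n + 1) k = 0 := by
  rw [indegProb_eq, Finset.sum_eq_zero fun j _ => degProb_eq_zero f n j k hk, zero_div]

theorem indegMean_eq (f : ℕ → ℝ) (n : ℕ) (h : ℕ → ℝ) :
    indegMean f (n + 1) h = (∑ j ∈ Finset.Icc 1 (n + 1), degMean f (n + 1) j h) / (n + 1) := by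
  simp only [indegMean, indegProb_eq, degMean]
  rw [Finset.sum_comm, Finset.sum_div]
  refine Finset.sum_congr rfl fun k _ => ?_
  rw [← Finset.sum_mul]
  ring

theorem indegMean_succ {f : ℕ → ℝ} (hf0 : ∀ k, 0 ≤ f k) (hf : ∀ k : ℕ, f k ≤ k + 1)
    (n : ℕ) (h : ℕ → ℝ) :
    (n + 2) * indegMean f (n + 2) h = h 0 + (n + 1) * indegMean f (n + 1) h +
      indegMean f (n + 1) (fun k => f k * (h (k + 1) - h k)) := by
  rw [indegMean_eq f (n + 1), Finset.sum_Icc_succ_top (by omega), degMean_last,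
    Finset.sum_congr rfl fun j hj => degMean_succ hf0 hf n j hj h, Finset.sum_add_distrib,
    indegMean_eq, indegMean_eq, ← Finset.sum_div]
  push_cast
  field_simp
  ring

theorem indegMean_one (f : ℕ → ℝ) (h : ℕ → ℝ) : indegMean f 1 h = h 0 := by
  simpa [degMean_last f 0] using indegMean_eq f 0 h

/-- The law of `W_{n+1}` is finitely supported, so `f` is integrable and the integral is a sum. -/
theorem lam_eq (f : ℕ → ℝ) (n : ℕ) : lam f (n + 2) = indegMean f (n + 1) f := by
  have hz : ∀ k ∉ Finset.range (n + 1), (indegreeLaw f (n + 1)).toMeasure.real {k} = 0 := by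
    intro k hk
    rw [measureReal_def, PMF.toMeasure_apply_singleton _ _ (by simp)]
    exact indegProb_eq_zero f n k (by simpa using hk)
  have hint : Integrable f (indegreeLaw f (n + 1)).toMeasure := by
    rw [← Measure.sum_smul_dirac (indegreeLaw f (n + 1)).toMeasure,
      integrable_sum_dirac_iff (fun _ => measure_ne_top _ _)]
    refine summable_of_ne_finset_zero (s := Finset.range (n + 1)) fun k hk => ?_
    have := hz k hk
    rw [measureReal_def] at this
    rw [this, zero_mul]
  rw [lam, show n + 2 - 1 = n + 1 from rfl, PMF.integral_eq_tsum _ _ hint, indegMean,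
    tsum_eq_sum (s := Finset.range (n + 1))]
  · rfl
  · intro k hk
    have := hz k hk
    rw [measureReal_def, PMF.toMeasure_apply_singleton _ _ (by simp)] at this
    rw [this, zero_smul]

/-! ### Poisson approximation of the outdegree -/

theorem le_add_one_of_le_affine {f : ℕ → ℝ} {γ : ℝ} (hγ1 : γ ≤ 1)
    (hf : ∀ k : ℕ, f k ≤ γ * k + 1) (k : ℕ) : f k ≤ k + 1 := by
  have : γ * k ≤ k := mul_le_of_le_one_left (Nat.cast_nonneg k) hγ1
  linarith [hf k]

theorem degMean_affine_succ_le {f : ℕ → ℝ} (hf0 : ∀ k, 0 ≤ f k) {γ : ℝ} (hγ0 : 0 ≤ γ)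
    (hγ1 : γ ≤ 1) (hf : ∀ k : ℕ, f k ≤ γ * k + 1) (n j : ℕ) (hj : j ∈ Finset.Icc 1 (n + 1)) :
    degMean f (n + 2) j (fun k => γ * k + 1) ≤
      (1 + γ / (n + 1)) * degMean f (n + 1) j (fun k => γ * k + 1) := by
  have hf' : ∀ k : ℕ, f k ≤ k + 1 := le_add_one_of_le_affine hγ1 hf
  rw [degMean_succ hf0 hf' n j hj, add_mul, one_mul, div_mul_eq_mul_div, ← degMean_const_mul]
  gcongr
  refine degMean_mono _ _ fun k => ?_
  have := hf k
  push_cast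
  nlinarith

/-- The factors `1 + γ / i`, `j ≤ i < n`, multiply up to order `(n / j) ^ γ`. The factor
`exp (1 / j - 1 / n)` makes the bound inductive. -/
theorem degMean_affine_le {f : ℕ → ℝ} (hf0 : ∀ k, 0 ≤ f k) {γ : ℝ} (hγ0 : 0 ≤ γ)
    (hγ1 : γ ≤ 1) (hf : ∀ k : ℕ, f k ≤ γ * k + 1) (j m : ℕ) :
    degMean f (j + m + 1) (j + 1) (fun k => γ * k + 1) ≤
      (Real.exp (1 / (j + 1) - 1 / (j + m + 1)) * ((j + m + 1) / (j + 1))) ^ γ := by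
  induction m with
  | zero =>
    rw [add_zero, degMean_last]
    have : ((j : ℝ) + 1) ≠ 0 := by positivity
    simp [this]
  | succ m ih =>
    have h1 := degMean_affine_succ_le hf0 hγ0 hγ1 hf (j + m) (j + 1) (by simp)
    refine h1.trans ?_
    push_cast
    set N : ℝ := (j : ℝ) + m + 1 with hN
    have hN0 : 0 < N := by positivity
    rw [show (j : ℝ) + (m + 1) + 1 = N + 1 by rw [hN]; ring]
    have h2 : 1 + γ / N ≤ Real.exp (1 / N) ^ γ := by
      rw [← Real.exp_mul, mul_comm, mul_one_div, add_comm]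
      exact Real.add_one_le_exp _
    have h3 : N * Real.exp (1 / (N + 1)) ≤ N + 1 := by
      have h4 := Real.one_sub_le_exp_neg (1 / (N + 1))
      rw [Real.exp_neg] at h4
      have h5 : 1 - 1 / (N + 1) = N / (N + 1) := by field_simp; ring
      rw [h5, div_le_iff₀ (by positivity), inv_mul_eq_div, le_div_iff₀ (Real.exp_pos _)] at h4
      exact h4
    calc (1 + γ / N) * degMean f (j + m + 1) (j + 1) (fun k => γ * k + 1)
        ≤ Real.exp (1 / N) ^ γ *
          (Real.exp (1 / (j + 1) - 1 / N) * (N / (j + 1))) ^ γ := by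
          gcongr
          exact degMean_nonneg _ _ fun k => by positivity
      _ = (Real.exp (1 / N) * (Real.exp (1 / (j + 1) - 1 / N) * (N / (j + 1)))) ^ γ := by
          rw [← Real.mul_rpow (by positivity) (by positivity)]
      _ ≤ _ := by
          refine Real.rpow_le_rpow (by positivity) ?_ hγ0
          rw [← mul_assoc, ← Real.exp_add, show 1 / N + (1 / ((j : ℝ) + 1) - 1 / N) =
            1 / ((j : ℝ) + 1) - 1 / (N + 1) + 1 / (N + 1) by ring, Real.exp_add, mul_assoc]
          gcongr
          rw [mul_div_assoc', mul_comm]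
          gcongr

theorem degMean_self_le {f : ℕ → ℝ} (hf0 : ∀ k, 0 ≤ f k) {γ : ℝ} (hγ0 : 0 ≤ γ)
    (hγ1 : γ ≤ 1) (hf : ∀ k : ℕ, f k ≤ γ * k + 1) (n j : ℕ) (hj : j ∈ Finset.Icc 1 (n + 1)) :
    degMean f (n + 1) j f ≤ 3 * (((n : ℝ) + 1) / j) ^ γ := by
  obtain ⟨h1, h2⟩ := Finset.mem_Icc.1 hj
  obtain ⟨i, rfl⟩ := Nat.exists_eq_add_of_le' h1
  obtain ⟨m, rfl⟩ := Nat.exists_eq_add_of_le (Nat.le_of_succ_le_succ h2)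
  refine (degMean_mono _ _ hf).trans ((degMean_affine_le hf0 hγ0 hγ1 hf i m).trans ?_)
  push_cast
  rw [Real.mul_rpow (by positivity) (by positivity)]
  gcongr
  have hi : 1 / ((i : ℝ) + 1) ≤ 1 := by
    rw [div_le_one (by positivity)]
    linarith [Nat.cast_nonneg (α := ℝ) i]
  have hm : 0 ≤ 1 / ((i : ℝ) + m + 1) := by positivity
  calc Real.exp (1 / (i + 1) - 1 / (i + m + 1)) ^ γ ≤ Real.exp 1 ^ γ :=
        Real.rpow_le_rpow (by positivity) (Real.exp_le_exp.2 (by linarith)) hγ0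
    _ ≤ Real.exp 1 ^ (1 : ℝ) :=
        Real.rpow_le_rpow_of_exponent_le (Real.one_le_exp zero_le_one) hγ1
    _ ≤ 3 := by rw [Real.rpow_one]; linarith [Real.exp_one_lt_d9]

theorem sum_edgeProb_sq_le {f : ℕ → ℝ} (hf0 : ∀ k, 0 ≤ f k) {γ : ℝ} (hγ0 : 0 ≤ γ)
    (hγ1 : γ ≤ 1) (hf : ∀ k : ℕ, f k ≤ γ * k + 1) (n : ℕ) :
    ∑ j ∈ Finset.Icc 1 (n + 1), (edgeProb f (n + 1) j).toReal ^ 2 ≤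
      9 * (((n : ℝ) + 1) ^ (2 * γ - 2) *
        ∑ j ∈ Finset.Icc 1 (n + 1), (j : ℝ) ^ (-(2 * γ))) := by
  have hf' : ∀ k : ℕ, f k ≤ k + 1 := le_add_one_of_le_affine hγ1 hf
  rw [Finset.mul_sum, Finset.mul_sum]
  refine Finset.sum_le_sum fun j hj => ?_
  have hj0 : (0 : ℝ) < j := by
    have := (Finset.mem_Icc.1 hj).1
    exact_mod_cast this
  have hn : (0 : ℝ) < (n : ℝ) + 1 := by positivity
  rw [toReal_edgeProb hf0 hf']
  calc (degMean f (n + 1) j f / (n + 1)) ^ 2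
      ≤ (3 * (((n : ℝ) + 1) / j) ^ γ / (n + 1)) ^ 2 := by
        have := degMean_nonneg (f := f) (n + 1) j hf0
        gcongr
        exact degMean_self_le hf0 hγ0 hγ1 hf n j hj
    _ = _ := by
        rw [Real.div_rpow hn.le hj0.le, Real.rpow_sub hn, Real.rpow_neg hj0.le, mul_comm 2 γ,
          Real.rpow_mul hn.le, Real.rpow_mul hj0.le]
        simp only [Real.rpow_two]
        field_simp
        norm_num

theorem sum_rpow_neg_le {s : ℝ} (hs0 : 0 ≤ s) (hs1 : s < 1) (n : ℕ) :
    ∑ j ∈ Finset.Icc 1 n, (j : ℝ) ^ (-s) ≤ (n : ℝ) ^ (1 - s) / (1 - s) := by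
  have hs : 0 < 1 - s := by linarith
  induction n with
  | zero => simp [Real.zero_rpow hs.ne']
  | succ n ih =>
    rw [Finset.sum_Icc_succ_top (by omega)]
    have hn : (0 : ℝ) < (n : ℝ) + 1 := by positivity
    have h1 : ((n : ℝ) / (n + 1)) ^ (1 - s) ≤ 1 + (1 - s) * (-1 / (n + 1)) := by
      have h := rpow_one_add_le_one_add_mul_self (s := -1 / ((n : ℝ) + 1)) (p := 1 - s)
        (by rw [le_div_iff₀ hn]; linarith [Nat.cast_nonneg (α := ℝ) n]) hs.le (by linarith)
      rwa [show 1 + -1 / ((n : ℝ) + 1) = n / (n + 1) by field_simp; ring] at h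
    rw [Real.div_rpow (by positivity) hn.le, div_le_iff₀ (by positivity)] at h1
    have h2 : ((n : ℝ) + 1) ^ (-s) = (n + 1) ^ (1 - s) / (n + 1) := by
      rw [show -s = 1 - s - 1 by ring, Real.rpow_sub_one hn.ne']
    push_cast
    rw [h2]
    calc _ ≤ (n : ℝ) ^ (1 - s) / (1 - s) + (n + 1) ^ (1 - s) / (n + 1) := by gcongr
      _ ≤ (1 + (1 - s) * (-1 / (n + 1))) * ((n : ℝ) + 1) ^ (1 - s) / (1 - s) +
          (n + 1) ^ (1 - s) / (n + 1) := by gcongr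
      _ = _ := by field_simp; ring

theorem exists_le_outdegreeRate {γ : ℝ} (hγ0 : 0 < γ) (hγ1 : γ < 1) :
    ∃ C : ℝ, 0 < C ∧ ∀ n : ℕ, ((n : ℝ) + 1) ^ (2 * γ - 2) *
      ∑ j ∈ Finset.Icc 1 (n + 1), (j : ℝ) ^ (-(2 * γ)) ≤ C * outdegreeRate γ (n + 2) := by
  unfold outdegreeRate
  rcases lt_trichotomy γ (1 / 2) with h | h | h
  · have h0 : 0 < 1 - 2 * γ := by linarith
    refine ⟨3 / (1 - 2 * γ), by positivity, fun n => ?_⟩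
    have hn : (0 : ℝ) < (n : ℝ) + 1 := by positivity
    rw [if_pos h]
    have h1 := sum_rpow_neg_le (s := 2 * γ) (by linarith) (by linarith) (n + 1)
    push_cast at h1 ⊢
    calc _ ≤ ((n : ℝ) + 1) ^ (2 * γ - 2) * (((n : ℝ) + 1) ^ (1 - 2 * γ) / (1 - 2 * γ)) := by
          gcongr
      _ = (1 / (1 - 2 * γ)) * (1 / ((n : ℝ) + 1)) := by
          rw [mul_div_assoc', ← Real.rpow_add hn, show 2 * γ - 2 + (1 - 2 * γ) = -1 by ring,
            Real.rpow_neg_one]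
          field_simp
      _ ≤ (1 / (1 - 2 * γ)) * (3 * (1 / ((n : ℝ) + 2 + 1))) := by
          gcongr
          rw [mul_one_div, div_le_div_iff₀ (by positivity) (by positivity)]
          linarith [Nat.cast_nonneg (α := ℝ) n]
      _ = _ := by ring
  · refine ⟨6, by norm_num, fun n => ?_⟩
    have hn : (0 : ℝ) < (n : ℝ) + 1 := by positivity
    have hn0 := Nat.cast_nonneg (α := ℝ) n
    rw [if_neg (by linarith), if_pos h, h]
    norm_num only
    have h1 := harmonic_le_one_add_log (n + 1)
    have h2 : ((harmonic (n + 1) : ℚ) : ℝ) = ∑ j ∈ Finset.Icc 1 (n + 1), (j : ℝ) ^ (-1 : ℝ) := by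
      rw [harmonic_eq_sum_Icc]
      push_cast
      exact Finset.sum_congr rfl fun j _ => (Real.rpow_neg_one _).symm
    rw [h2] at h1
    push_cast at h1 ⊢
    have h3 : Real.log ((n : ℝ) + 1) ≤ Real.log (n + 2) := Real.log_le_log hn (by linarith)
    have h4 : (1 : ℝ) / 2 ≤ Real.log (n + 2) := by
      have := Real.log_two_gt_d9
      have := Real.log_le_log (x := 2) (y := (n : ℝ) + 2) (by norm_num) (by linarith)
      linarith
    rw [Real.rpow_neg_one]
    calc ((n : ℝ) + 1)⁻¹ * ∑ j ∈ Finset.Icc 1 (n + 1), (j : ℝ) ^ (-1 : ℝ)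
        ≤ ((n : ℝ) + 1)⁻¹ * (3 * Real.log (n + 2)) := by
          gcongr
          linarith
      _ ≤ (2 * (1 / ((n : ℝ) + 2))) * (3 * Real.log (n + 2)) := by
          gcongr
          rw [mul_one_div, inv_eq_one_div, div_le_div_iff₀ (by positivity) (by positivity)]
          linarith
      _ = _ := by ring
  · have hs : Summable fun j : ℕ => (j : ℝ) ^ (-(2 * γ)) :=
      Real.summable_nat_rpow.2 (by linarith)
    have hT : 0 ≤ ∑' j : ℕ, (j : ℝ) ^ (-(2 * γ)) := tsum_nonneg fun j => by positivity
    refine ⟨4 * (∑' j : ℕ, (j : ℝ) ^ (-(2 * γ)) + 1), by positivity, fun n => ?_⟩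
    have hn : (0 : ℝ) < (n : ℝ) + 1 := by positivity
    rw [if_neg (by linarith), if_neg (by linarith)]
    have h1 : ∑ j ∈ Finset.Icc 1 (n + 1), (j : ℝ) ^ (-(2 * γ)) ≤
        ∑' j : ℕ, (j : ℝ) ^ (-(2 * γ)) :=
      hs.sum_le_tsum _ fun j _ => by positivity
    have h2 : ((n : ℝ) + 1) ^ (2 * γ - 2) ≤ 4 * ((n : ℝ) + 2) ^ (2 * γ - 2) := by
      calc ((n : ℝ) + 1) ^ (2 * γ - 2) ≤ (((n : ℝ) + 2) / 2) ^ (2 * γ - 2) :=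
            Real.rpow_le_rpow_of_nonpos (by positivity)
              (by linarith [Nat.cast_nonneg (α := ℝ) n]) (by linarith)
        _ = (2 : ℝ) ^ (2 - 2 * γ) * ((n : ℝ) + 2) ^ (2 * γ - 2) := by
            rw [Real.div_rpow (by positivity) (by norm_num), div_eq_inv_mul,
              ← Real.rpow_neg (by norm_num), neg_sub]
        _ ≤ (2 : ℝ) ^ (2 : ℝ) * ((n : ℝ) + 2) ^ (2 * γ - 2) := by
            gcongr
            · norm_num
            · linarith
        _ = _ := by norm_num
    push_cast
    calc _ ≤ (4 * ((n : ℝ) + 2) ^ (2 * γ - 2)) * (∑' j : ℕ, (j : ℝ) ^ (-(2 * γ)) + 1) := by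
          gcongr
          linarith
      _ = _ := by rw [show -2 * (1 - γ) = 2 * γ - 2 by ring]; ring

theorem tvDist_outdegreeLaw_le {f : ℕ → ℝ} (hf0 : ∀ k, 0 ≤ f k) (hf : ∀ k : ℕ, f k ≤ k + 1)
    (n : ℕ) :
    tvDist (outdegreeLaw f (n + 2)).toMeasure (poissonMeasure (lam f (n + 2)).toNNReal) ≤
      ∑ j ∈ Finset.Icc 1 (n + 1), (edgeProb f (n + 1) j).toReal ^ 2 := by
  have hlam : (lam f (n + 2)).toNNReal =
      ∑ j ∈ Finset.Icc 1 (n + 1), (edgeProb f (n + 1) j).toNNReal := by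
    have h : lam f (n + 2) = ∑ j ∈ Finset.Icc 1 (n + 1), (edgeProb f (n + 1) j).toReal := by
      rw [lam_eq, indegMean_eq, Finset.sum_div]
      exact Finset.sum_congr rfl fun j _ => (toReal_edgeProb hf0 hf n j).symm
    rw [h]
    refine NNReal.eq ?_
    rw [Real.coe_toNNReal _ (Finset.sum_nonneg fun j _ => ENNReal.toReal_nonneg)]
    push_cast
    rfl
  have : Nonempty {A : Set ℕ // MeasurableSet A} := ⟨⟨∅, MeasurableSet.empty⟩⟩
  refine ciSup_le fun A => ?_
  rw [hlam, outdegreeLaw_eq]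
  exact abs_real_map_card_sub_poisson_le _ _ _ _

theorem exists_tvDist_outdegreeLaw_le {f : ℕ → ℝ} (hf0 : ∀ k, 0 ≤ f k) {γ : ℝ} (hγ0 : 0 < γ)
    (hγ1 : γ < 1) (hf : ∀ k : ℕ, f k ≤ γ * k + 1) :
    ∃ C : ℝ, 0 < C ∧ ∀ n : ℕ, 2 ≤ n →
      tvDist (outdegreeLaw f n).toMeasure (poissonMeasure (lam f n).toNNReal)
        ≤ C * outdegreeRate γ n := by
  have hf' : ∀ k : ℕ, f k ≤ k + 1 := le_add_one_of_le_affine hγ1.le hf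
  obtain ⟨C, hC, h⟩ := exists_le_outdegreeRate hγ0 hγ1
  refine ⟨9 * C, by positivity, fun n hn => ?_⟩
  obtain ⟨m, rfl⟩ := Nat.exists_eq_add_of_le' hn
  have h1 := tvDist_outdegreeLaw_le hf0 hf' m
  have h2 := sum_edgeProb_sq_le hf0 hγ0.le hγ1.le hf m
  have h3 := h m
  linarith

/-! ### Convergence of the indegree distribution -/

/-- Stochastic approximation: the recursion contracts towards its fixed point `b / (1 + a)`, with
an error that is a Cesàro mean of the perturbations `β n - b`. -/
theorem tendsto_of_recursion {x β : ℕ → ℝ} {a b : ℝ} (ha : 0 ≤ a)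
    (hx : ∀ n : ℕ, (n + 2) * x (n + 1) = (n + 1 - a) * x n + β n)
    (hβ : Tendsto β atTop (𝓝 b)) : Tendsto x atTop (𝓝 (b / (1 + a))) := by
  set y : ℕ → ℝ := fun n => x n - b / (1 + a) with hy
  have hrec : ∀ n : ℕ, (n + 2) * y (n + 1) = (n + 1 - a) * y n + (β n - b) := by
    intro n
    have h1 : b / (1 + a) * (1 + a) = b := div_mul_cancel₀ _ (by positivity)
    simp only [hy]
    linear_combination hx n - h1
  -- From time `N` on the factor `n + 1 - a` is nonnegative, hence at most `n + 1` in modulus.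
  obtain ⟨N, hN⟩ := exists_nat_ge a
  have hbound : ∀ n : ℕ, N ≤ n →
      (n + 1) * |y n| ≤ (N + 1) * |y N| + ∑ i ∈ Finset.range n, |β i - b| := by
    intro n hn
    induction n, hn using Nat.le_induction with
    | base =>
      have : 0 ≤ ∑ i ∈ Finset.range N, |β i - b| := Finset.sum_nonneg fun _ _ => abs_nonneg _
      linarith
    | succ n hn ih =>
      have hnN : (N : ℝ) ≤ n := by exact_mod_cast hn
      have h1 : ((n : ℝ) + 2) * |y (n + 1)| ≤ (n + 1 - a) * |y n| + |β n - b| := by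
        rw [← abs_of_nonneg (show (0 : ℝ) ≤ (n : ℝ) + 2 by positivity), ← abs_mul, hrec n]
        refine (abs_add_le _ _).trans_eq ?_
        rw [abs_mul, abs_of_nonneg (show (0 : ℝ) ≤ (n : ℝ) + 1 - a by linarith)]
      have h2 : 0 ≤ a * |y n| := mul_nonneg ha (abs_nonneg _)
      rw [Finset.sum_range_succ]
      push_cast
      linarith
  have hy0 : Tendsto y atTop (𝓝 0) := by
    have h1 : Tendsto (fun n : ℕ => (n : ℝ)⁻¹ * ((N + 1) * |y N|) +
        (n : ℝ)⁻¹ * ∑ i ∈ Finset.range n, |β i - b|) atTop (𝓝 0) := by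
      have h2 : Tendsto (fun n => |β n - b|) atTop (𝓝 0) := by
        simpa using (hβ.sub_const b).abs
      simpa using (tendsto_inv_atTop_nhds_zero_nat.mul_const ((N + 1) * |y N|)).add h2.cesaro
    refine squeeze_zero_norm' ?_ h1
    filter_upwards [eventually_ge_atTop N, eventually_gt_atTop 0] with n hn hn0
    have hn0' : (0 : ℝ) < n := by exact_mod_cast hn0
    rw [Real.norm_eq_abs, ← mul_add, inv_mul_eq_div, le_div_iff₀ hn0']
    have := hbound n hn
    have := abs_nonneg (y n)
    linarith
  simpa [hy] using hy0.add_const (b / (1 + a))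

theorem indegMean_single (f : ℕ → ℝ) (n k : ℕ) (h : ℕ → ℝ) :
    indegMean f (n + 1) (fun d => if d = k then h d else 0) = indegProb f (n + 1) k * h k := by
  rw [indegMean]
  simp only [mul_ite, mul_zero]
  rw [Finset.sum_ite_eq']
  split_ifs with hk
  · rfl
  · rw [indegProb_eq_zero f n k (by simpa using hk), zero_mul]

theorem indegProb_succ_zero {f : ℕ → ℝ} (hf0 : ∀ k, 0 ≤ f k) (hf : ∀ k : ℕ, f k ≤ k + 1)
    (n : ℕ) :
    (n + 2) * indegProb f (n + 2) 0 = (n + 1 - f 0) * indegProb f (n + 1) 0 + 1 := by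
  have h := indegMean_succ hf0 hf n fun d => if d = 0 then 1 else 0
  have h1 := indegMean_single f (n + 1) 0 fun _ => 1
  have h2 := indegMean_single f n 0 fun _ => 1
  have h3 := indegMean_single f n 0 fun d => -f d
  have h4 : (fun k => f k * ((if k + 1 = 0 then (1 : ℝ) else 0) - if k = 0 then 1 else 0)) =
      fun d => if d = 0 then -f d else 0 := by
    funext d
    by_cases hd : d = 0 <;> simp [hd]
  rw [h4, h1, h2, h3, if_pos rfl] at h
  linear_combination h

theorem indegProb_succ_succ {f : ℕ → ℝ} (hf0 : ∀ k, 0 ≤ f k) (hf : ∀ k : ℕ, f k ≤ k + 1)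
    (n k : ℕ) :
    (n + 2) * indegProb f (n + 2) (k + 1) =
      (n + 1 - f (k + 1)) * indegProb f (n + 1) (k + 1) + f k * indegProb f (n + 1) k := by
  have h := indegMean_succ hf0 hf n fun d => if d = k + 1 then 1 else 0
  have h1 := indegMean_single f (n + 1) (k + 1) fun _ => 1
  have h2 := indegMean_single f n (k + 1) fun _ => 1
  have h3 := indegMean_single f n (k + 1) f
  have h4 := indegMean_single f n k f
  have h5 : indegMean f (n + 1) (fun d => f d * ((if d + 1 = k + 1 then (1 : ℝ) else 0) -
      if d = k + 1 then 1 else 0)) =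
      indegMean f (n + 1) (fun d => if d = k then f d else 0) -
        indegMean f (n + 1) (fun d => if d = k + 1 then f d else 0) := by
    simp only [indegMean]
    rw [← Finset.sum_sub_distrib]
    refine Finset.sum_congr rfl fun d _ => ?_
    simp only [Nat.add_right_cancel_iff]
    split_ifs <;> ring
  rw [h5, h1, h2, h3, h4, if_neg (by omega)] at h
  linear_combination h

theorem limitWeight_nonneg {f : ℕ → ℝ} (hf0 : ∀ k, 0 ≤ f k) (k : ℕ) : 0 ≤ limitWeight f k := by
  have h : ∀ i, 0 ≤ 1 + f i := fun i => by linarith [hf0 i]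
  exact mul_nonneg (div_nonneg zero_le_one (h k))
    (Finset.prod_nonneg fun i _ => div_nonneg (hf0 i) (h i))

theorem tendsto_indegProb {f : ℕ → ℝ} (hf0 : ∀ k, 0 ≤ f k) (hf : ∀ k : ℕ, f k ≤ k + 1)
    (k : ℕ) : Tendsto (fun n => indegProb f (n + 1) k) atTop (𝓝 (limitWeight f k)) := by
  induction k with
  | zero =>
    have h := tendsto_of_recursion (hf0 0) (x := fun n => indegProb f (n + 1) 0)
      (indegProb_succ_zero hf0 hf) tendsto_const_nhds
    simpa [limitWeight] using h
  | succ k ih =>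
    have h := tendsto_of_recursion (hf0 (k + 1)) (x := fun n => indegProb f (n + 1) (k + 1))
      (fun n => indegProb_succ_succ hf0 hf n k) (ih.const_mul (f k))
    convert h using 2
    have := hf0 k
    have := hf0 (k + 1)
    rw [limitWeight, limitWeight, Finset.prod_range_succ]
    field_simp

/-! ### Uniform integrability -/

/-- Replaces the factors `1 - δ / x` by ones whose product over `x, x + 1, …` telescopes. -/
theorem one_sub_div_le_rpow {δ x : ℝ} (hδ : 0 ≤ δ) (hx : 0 < x) :
    1 - δ / x ≤ (x / (x + 1)) ^ δ := by
  have h1 : Real.exp (-(1 / x)) ≤ x / (x + 1) := by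
    have h := Real.add_one_le_exp (1 / x)
    rw [Real.exp_neg, inv_eq_one_div, div_le_div_iff₀ (Real.exp_pos _) (by positivity)]
    calc 1 * (x + 1) = x * (1 / x + 1) := by field_simp; ring
      _ ≤ x * Real.exp (1 / x) := by gcongr
  calc 1 - δ / x ≤ Real.exp (-(δ / x)) := Real.one_sub_le_exp_neg _
    _ = Real.exp (-(1 / x)) ^ δ := by rw [← Real.exp_mul]; congr 1; ring
    _ ≤ _ := Real.rpow_le_rpow (Real.exp_pos _).le h1 hδ

theorem le_rpow_of_recursion {u : ℕ → ℝ} {δ : ℝ} (hδ : 0 ≤ δ) (hu0 : ∀ n, 0 ≤ u n)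
    (hu : ∀ n : ℕ, u (n + 1) ≤ (1 - δ / (n + 2)) * u n) (n : ℕ) :
    u n ≤ (2 / ((n : ℝ) + 2)) ^ δ * u 0 := by
  induction n with
  | zero => simp
  | succ n ih =>
    have h0 : (0 : ℝ) < (n : ℝ) + 2 := by positivity
    calc u (n + 1) ≤ (1 - δ / (n + 2)) * u n := hu n
      _ ≤ ((n + 2) / (n + 2 + 1)) ^ δ * ((2 / ((n : ℝ) + 2)) ^ δ * u 0) := by
          have := hu0 n
          gcongr
          exact one_sub_div_le_rpow hδ h0
      _ = _ := by
          rw [← mul_assoc, ← Real.mul_rpow (by positivity) (by positivity)]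
          push_cast
          congr 2
          field_simp
          ring

/-- A test function of growth `k ^ (c / γ)`, made so that its drift under the dynamics is at
most `c` times itself. -/
noncomputable def testFun (γ c : ℝ) (k : ℕ) : ℝ := ∏ i ∈ Finset.range k, (1 + c / (γ * i + 1))

theorem testFun_pos {γ c : ℝ} (hγ : 0 ≤ γ) (hc : 0 ≤ c) (k : ℕ) : 0 < testFun γ c k :=
  Finset.prod_pos fun i _ => by positivity

theorem indegMean_testFun_le {f : ℕ → ℝ} (hf0 : ∀ k, 0 ≤ f k) {γ c : ℝ} (hγ0 : 0 ≤ γ)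
    (hγ1 : γ ≤ 1) (hc0 : 0 ≤ c) (hc1 : c < 1) (hf : ∀ k : ℕ, f k ≤ γ * k + 1) (n : ℕ) :
    indegMean f (n + 1) (testFun γ c) ≤ 1 / (1 - c) := by
  have hf' : ∀ k : ℕ, f k ≤ k + 1 := le_add_one_of_le_affine hγ1 hf
  have hc : 0 < 1 - c := by linarith
  induction n with
  | zero =>
    rw [zero_add, indegMean_one, testFun, Finset.range_zero, Finset.prod_empty,
      le_div_iff₀ hc]
    linarith
  | succ n ih =>
    have h1 := indegMean_succ hf0 hf' n (testFun γ c)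
    have h2 : indegMean f (n + 1) (fun k => f k * (testFun γ c (k + 1) - testFun γ c k)) ≤
        c * indegMean f (n + 1) (testFun γ c) := by
      rw [indegMean, indegMean, Finset.mul_sum]
      refine Finset.sum_le_sum fun k _ => ?_
      have h3 : testFun γ c (k + 1) - testFun γ c k = testFun γ c k * (c / (γ * k + 1)) := by
        rw [testFun, testFun, Finset.prod_range_succ]
        ring
      have h4 : f k * (c / (γ * k + 1)) ≤ c := by
        rw [mul_div_assoc', div_le_iff₀ (by positivity), mul_comm]
        exact mul_le_mul_of_nonneg_left (hf k) hc0
      have h5 := mul_nonneg (indegProb_nonneg f (n + 1) k) (testFun_pos hγ0 hc0 k).le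
      rw [h3]
      nlinarith
    have h6 : testFun γ c 0 = 1 := by simp [testFun]
    rw [le_div_iff₀ hc] at ih ⊢
    have h7 : ((n : ℝ) + 2) * (indegMean f (n + 2) (testFun γ c) * (1 - c)) ≤ (n + 2) * 1 := by
      have h8 : ((n : ℝ) + 1 + c) * (indegMean f (n + 1) (testFun γ c) * (1 - c)) ≤
          (n + 1 + c) * 1 := by gcongr
      nlinarith
    exact le_of_mul_le_mul_left h7 (by positivity)

/-- For `c > γ` the test function grows faster than linearly. -/
theorem tendsto_affine_div_testFun {γ c : ℝ} (hγ0 : 0 ≤ γ) (hγc : γ < c) (hc1 : c < 1) :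
    Tendsto (fun k : ℕ => (γ * k + 1) / testFun γ c k) atTop (𝓝 0) := by
  have hc0 : 0 ≤ c := hγ0.trans hγc.le
  have hpos : ∀ k : ℕ, 0 ≤ (γ * k + 1) / testFun γ c k := fun k =>
    div_nonneg (by positivity) (testFun_pos hγ0 hc0 k).le
  have hδ : 0 < c - γ := by linarith
  have hrec := le_rpow_of_recursion (u := fun k : ℕ => (γ * k + 1) / testFun γ c k) hδ.le hpos
    (by
      intro k
      have hg := testFun_pos hγ0 hc0 k
      have hk : γ * k ≤ k := mul_le_of_le_one_left (Nat.cast_nonneg k) (by linarith)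
      have hk0 : 0 ≤ γ * k := by positivity
      have h1 : (γ * (k + 1 : ℕ) + 1) / testFun γ c (k + 1) =
          (1 - (c - γ) / (γ * k + 1 + c)) * ((γ * k + 1) / testFun γ c k) := by
        rw [testFun, Finset.prod_range_succ, ← testFun]
        push_cast
        field_simp
        ring
      rw [h1]
      refine mul_le_mul_of_nonneg_right ?_ (hpos k)
      exact sub_le_sub_left
        (div_le_div_of_nonneg_left hδ.le (by linarith) (by linarith)) _)
  have hlim : Tendsto (fun k : ℕ => (2 / ((k : ℝ) + 2)) ^ (c - γ) *
      ((γ * (0 : ℕ) + 1) / testFun γ c 0)) atTop (𝓝 0) := by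
    have h1 : Tendsto (fun k : ℕ => 2 / ((k : ℝ) + 2)) atTop (𝓝 0) :=
      tendsto_const_nhds.div_atTop (tendsto_atTop_add_const_right _ _ tendsto_natCast_atTop_atTop)
    simpa [Real.zero_rpow hδ.ne'] using (h1.rpow_const (Or.inr hδ.le)).mul_const
      ((γ * (0 : ℕ) + 1) / testFun γ c 0)
  exact squeeze_zero hpos hrec hlim

/-- Convergence of expectations from pointwise convergence of the weights, when a moment that
dominates `h` is bounded. -/
theorem summable_and_tendsto_of_moment_le {a : ℕ → ℕ → ℝ} {μ g h : ℕ → ℝ} {M : ℝ}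
    (ha : ∀ n k, 0 ≤ a n k) (hlim : ∀ k, Tendsto (fun n => a n k) atTop (𝓝 (μ k)))
    (hg : ∀ k, 0 < g k) (hM : ∀ n, ∑ k ∈ Finset.range (n + 1), a n k * g k ≤ M)
    (hr : Tendsto (fun k => h k / g k) atTop (𝓝 0)) :
    Summable (fun k => μ k * h k) ∧
      Tendsto (fun n => ∑ k ∈ Finset.range (n + 1), a n k * h k) atTop
        (𝓝 (∑' k, μ k * h k)) := by
  have hμ : ∀ k, 0 ≤ μ k := fun k => ge_of_tendsto' (hlim k) fun n => ha n k
  have hpart : ∀ (h' : ℕ → ℝ) (K : ℕ), Tendsto (fun n => ∑ k ∈ Finset.range K, a n k * h' k)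
      atTop (𝓝 (∑ k ∈ Finset.range K, μ k * h' k)) := fun h' K =>
    tendsto_finsetSum _ fun k _ => (hlim k).mul_const _
  have hsg : Summable fun k => μ k * g k := by
    refine summable_of_sum_range_le (c := M) (fun k => mul_nonneg (hμ k) (hg k).le) fun K => ?_
    refine le_of_tendsto (hpart g K) ?_
    filter_upwards [eventually_ge_atTop K] with n hn
    refine le_trans ?_ (hM n)
    exact Finset.sum_le_sum_of_subset_of_nonneg (Finset.range_subset_range.2 (by omega))
      fun k _ _ => mul_nonneg (ha n k) (hg k).le
  have hsmall : ∀ η : ℝ, 0 < η → ∀ᶠ k in atTop, |h k| ≤ η * g k := by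
    intro η hη
    filter_upwards [(Metric.tendsto_atTop.1 hr η hη).choose_spec |> fun H =>
      (eventually_atTop.2 ⟨_, H⟩ : ∀ᶠ k in atTop, dist (h k / g k) 0 < η)] with k hk
    rw [Real.dist_eq, sub_zero, abs_div, abs_of_pos (hg k), div_lt_iff₀ (hg k)] at hk
    exact hk.le
  have hsh : Summable fun k => μ k * h k := by
    refine hsg.of_norm_bounded_eventually_nat ?_
    filter_upwards [hsmall 1 one_pos] with k hk
    rw [Real.norm_eq_abs, abs_mul, abs_of_nonneg (hμ k)]
    exact mul_le_mul_of_nonneg_left (by linarith) (hμ k)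
  refine ⟨hsh, Metric.tendsto_atTop'.2 fun ε hε => ?_⟩
  have hM0 : 0 ≤ M := le_trans (Finset.sum_nonneg fun k _ => mul_nonneg (ha 0 k) (hg k).le) (hM 0)
  obtain ⟨K₁, hK₁⟩ := eventually_atTop.1 (hsmall (ε / (3 * (M + 1))) (by positivity))
  obtain ⟨K₂, hK₂⟩ := Metric.tendsto_atTop.1 hsh.hasSum.tendsto_sum_nat (ε / 3) (by positivity)
  set K := max K₁ K₂
  obtain ⟨N, hN⟩ := Metric.tendsto_atTop.1 (hpart h K) (ε / 3) (by positivity)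
  refine ⟨max N K, fun n hn => ?_⟩
  have d1 := hN n (by omega)
  have d2 := hK₂ K (le_max_right _ _)
  have d3 : dist (∑ k ∈ Finset.range (n + 1), a n k * h k)
      (∑ k ∈ Finset.range K, a n k * h k) ≤ ε / 3 := by
    rw [Real.dist_eq, ← Finset.sum_Ico_eq_sub _ (by omega)]
    calc |∑ k ∈ Finset.Ico K (n + 1), a n k * h k|
        ≤ ∑ k ∈ Finset.Ico K (n + 1), |a n k * h k| := Finset.abs_sum_le_sum_abs _ _
      _ ≤ ∑ k ∈ Finset.Ico K (n + 1), ε / (3 * (M + 1)) * (a n k * g k) := by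
          refine Finset.sum_le_sum fun k hk => ?_
          have hkK := (Finset.mem_Ico.1 hk).1
          rw [abs_mul, abs_of_nonneg (ha n k), mul_left_comm]
          exact mul_le_mul_of_nonneg_left (hK₁ k (le_trans (le_max_left _ _) hkK)) (ha n k)
      _ ≤ ∑ k ∈ Finset.range (n + 1), ε / (3 * (M + 1)) * (a n k * g k) := by
          refine Finset.sum_le_sum_of_subset_of_nonneg (fun k hk => ?_) fun k _ _ => ?_
          · exact Finset.mem_range.2 (Finset.mem_Ico.1 hk).2
          · have := mul_nonneg (ha n k) (hg k).le
            positivity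
      _ ≤ ε / (3 * (M + 1)) * (M + 1) := by
          rw [← Finset.mul_sum]
          gcongr
          linarith [hM n]
      _ = ε / 3 := by field_simp
  have := dist_triangle4 (∑ k ∈ Finset.range (n + 1), a n k * h k)
    (∑ k ∈ Finset.range K, a n k * h k) (∑ k ∈ Finset.range K, μ k * h k) (∑' k, μ k * h k)
  linarith

theorem summable_and_tendsto_indegMean {f : ℕ → ℝ} (hf0 : ∀ k, 0 ≤ f k) {γ : ℝ} (hγ0 : 0 ≤ γ)
    (hγ1 : γ < 1) (hf : ∀ k : ℕ, f k ≤ γ * k + 1) {h : ℕ → ℝ} (hh0 : ∀ k, 0 ≤ h k)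
    (hh : ∀ k : ℕ, h k ≤ γ * k + 1) :
    Summable (fun k => limitWeight f k * h k) ∧
      Tendsto (fun n => indegMean f (n + 1) h) atTop (𝓝 (∑' k, limitWeight f k * h k)) := by
  have hf' : ∀ k : ℕ, f k ≤ k + 1 := le_add_one_of_le_affine hγ1.le hf
  -- Any drift constant `c` strictly between `γ` and `1` would do; take the midpoint.
  have hc0 : 0 ≤ (1 + γ) / 2 := by positivity
  have hc1 : (1 + γ) / 2 < 1 := by linarith
  have hg := testFun_pos hγ0 hc0
  refine summable_and_tendsto_of_moment_le (fun n k => indegProb_nonneg f (n + 1) k)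
    (tendsto_indegProb hf0 hf') hg (indegMean_testFun_le hf0 hγ0 hγ1.le hc0 hc1 hf) ?_
  refine squeeze_zero (fun k => div_nonneg (hh0 k) (hg k).le) (fun k => ?_)
    (tendsto_affine_div_testFun hγ0 (by linarith) hc1)
  have := hg k
  gcongr
  exact hh k

theorem indegMean_const_one {f : ℕ → ℝ} (hf0 : ∀ k, 0 ≤ f k) (hf : ∀ k : ℕ, f k ≤ k + 1)
    (n : ℕ) : indegMean f (n + 1) (fun _ => 1) = 1 := by
  induction n with
  | zero => exact indegMean_one f _
  | succ n ih =>
    have h := indegMean_succ hf0 hf n fun _ => 1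
    have h0 : indegMean f (n + 1) (fun k => f k * (1 - 1)) = 0 := by simp [indegMean]
    rw [h0, ih] at h
    have h1 : ((n : ℝ) + 2) ≠ 0 := by positivity
    exact mul_left_cancel₀ h1 (by linarith)

/-! ### The limit law -/

theorem hasSum_limitWeight {f : ℕ → ℝ} (hf0 : ∀ k, 0 ≤ f k) {γ : ℝ} (hγ0 : 0 ≤ γ)
    (hγ1 : γ < 1) (hf : ∀ k : ℕ, f k ≤ γ * k + 1) : HasSum (limitWeight f) 1 := by
  have hf' : ∀ k : ℕ, f k ≤ k + 1 := le_add_one_of_le_affine hγ1.le hf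
  obtain ⟨h1, h2⟩ := summable_and_tendsto_indegMean hf0 hγ0 hγ1 hf (h := fun _ => 1)
    (fun _ => zero_le_one) fun k => by
      have : 0 ≤ γ * k := by positivity
      linarith
  simp only [indegMean_const_one hf0 hf', mul_one] at h1 h2
  rw [tendsto_nhds_unique tendsto_const_nhds h2]
  exact h1.hasSum

theorem isProbabilityMeasure_limitLaw {f : ℕ → ℝ} (hf0 : ∀ k, 0 ≤ f k) {γ : ℝ} (hγ0 : 0 ≤ γ)
    (hγ1 : γ < 1) (hf : ∀ k : ℕ, f k ≤ γ * k + 1) : IsProbabilityMeasure (limitLaw f) :=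
  (hasSum_limitWeight hf0 hγ0 hγ1 hf).isProbabilityMeasure_sum_dirac (limitWeight_nonneg hf0)

theorem integrable_limitLaw {f : ℕ → ℝ} (hf0 : ∀ k, 0 ≤ f k) {γ : ℝ} (hγ0 : 0 ≤ γ)
    (hγ1 : γ < 1) (hf : ∀ k : ℕ, f k ≤ γ * k + 1) : Integrable f (limitLaw f) := by
  refine integrable_sum_dirac (fun _ => ENNReal.ofReal_ne_top) ?_
  simp only [ENNReal.toReal_ofReal (limitWeight_nonneg hf0 _), Real.norm_eq_abs,
    abs_of_nonneg (hf0 _)]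
  exact (summable_and_tendsto_indegMean hf0 hγ0 hγ1 hf hf0 hf).1

theorem tendsto_lam {f : ℕ → ℝ} (hf0 : ∀ k, 0 ≤ f k) {γ : ℝ} (hγ0 : 0 ≤ γ)
    (hγ1 : γ < 1) (hf : ∀ k : ℕ, f k ≤ γ * k + 1) :
    Tendsto (lam f) atTop (𝓝 (∫ k, f k ∂(limitLaw f))) := by
  rw [← tendsto_add_atTop_iff_nat 2, limitLaw,
    integral_sum_dirac (fun _ => ENNReal.ofReal_ne_top)]
  simp only [lam_eq, ENNReal.toReal_ofReal (limitWeight_nonneg hf0 _), smul_eq_mul]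
  exact (summable_and_tendsto_indegMean hf0 hγ0 hγ1 hf hf0 hf).2

/-- For an affine attachment rule, `lam f n` solves a closed linear recursion with fixed point
`β / (1 - γ)`. -/
theorem abs_lam_sub_le {f : ℕ → ℝ} {γ β : ℝ} (hγ0 : 0 ≤ γ) (hγ1 : γ < 1)
    (hβ : β ∈ Set.Icc (0 : ℝ) 1) (hf : ∀ k : ℕ, f k = γ * k + β) (n : ℕ) :
    |lam f (n + 2) - β / (1 - γ)| ≤
      (2 / ((n : ℝ) + 2)) ^ (1 - γ) * |lam f 2 - β / (1 - γ)| := by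
  have hγ : 0 < 1 - γ := by linarith
  have hf0 : ∀ k, 0 ≤ f k := fun k => by
    rw [hf]
    have := hβ.1
    positivity
  have hf' : ∀ k : ℕ, f k ≤ k + 1 := fun k => by
    have : γ * k ≤ k := mul_le_of_le_one_left (Nat.cast_nonneg k) hγ1.le
    rw [hf]
    linarith [hβ.2]
  refine le_rpow_of_recursion (u := fun n => |lam f (n + 2) - β / (1 - γ)|) hγ.le
    (fun _ => abs_nonneg _) (fun n => le_of_eq ?_) n
  have hn : (0 : ℝ) < (n : ℝ) + 2 := by positivity
  have hrec := indegMean_succ hf0 hf' n f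
  have hdrift : indegMean f (n + 1) (fun k => f k * (f (k + 1) - f k)) =
      γ * indegMean f (n + 1) f := by
    rw [indegMean, indegMean, Finset.mul_sum]
    refine Finset.sum_congr rfl fun k _ => ?_
    rw [hf (k + 1), hf k]
    push_cast
    ring
  have h0 : f 0 = β := by simp [hf]
  rw [hdrift, h0, ← lam_eq, ← lam_eq] at hrec
  have hnn : 0 ≤ 1 - (1 - γ) / ((n : ℝ) + 2) := by
    rw [sub_nonneg, div_le_one hn]
    linarith [Nat.cast_nonneg (α := ℝ) n]
  rw [← abs_of_nonneg hnn, ← abs_mul]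
  congr 1
  refine mul_left_cancel₀ hn.ne' ?_
  have h1 : β / (1 - γ) * (1 - γ) = β := div_mul_cancel₀ _ hγ.ne'
  have h2 : ((n : ℝ) + 2) * ((1 - (1 - γ) / (n + 2)) * (lam f (n + 2) - β / (1 - γ))) =
      (n + 1 + γ) * (lam f (n + 2) - β / (1 - γ)) := by
    field_simp
    ring
  rw [h2]
  linear_combination hrec - h1

theorem exists_abs_lam_sub_integral_le {f : ℕ → ℝ} {γ β : ℝ} (hγ0 : 0 ≤ γ) (hγ1 : γ < 1)
    (hβ : β ∈ Set.Icc (0 : ℝ) 1) (hf : ∀ k : ℕ, f k = γ * k + β) :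
    ∃ C : ℝ, 0 < C ∧ ∀ n : ℕ, 2 ≤ n →
      |lam f n - ∫ k, f k ∂(limitLaw f)| ≤ C * (n : ℝ) ^ (-1 + γ) := by
  have hγ : 0 < 1 - γ := by linarith
  have hf0 : ∀ k, 0 ≤ f k := fun k => by
    rw [hf]
    have := hβ.1
    positivity
  -- Both limits of `lam f` agree, which evaluates the integral.
  have hint : ∫ k, f k ∂(limitLaw f) = β / (1 - γ) := by
    refine tendsto_nhds_unique (tendsto_lam hf0 hγ0 hγ1 fun k => by rw [hf]; linarith [hβ.2]) ?_
    rw [← tendsto_add_atTop_iff_nat 2, tendsto_iff_norm_sub_tendsto_zero]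
    refine squeeze_zero (fun _ => norm_nonneg _) (abs_lam_sub_le hγ0 hγ1 hβ hf) ?_
    have h1 : Tendsto (fun k : ℕ => 2 / ((k : ℝ) + 2)) atTop (𝓝 0) :=
      tendsto_const_nhds.div_atTop (tendsto_atTop_add_const_right _ _ tendsto_natCast_atTop_atTop)
    simpa [Real.zero_rpow hγ.ne'] using (h1.rpow_const (Or.inr hγ.le)).mul_const
      |lam f 2 - β / (1 - γ)|
  rw [hint]
  refine ⟨2 ^ (1 - γ) * |lam f 2 - β / (1 - γ)| + 1, by positivity, fun n hn => ?_⟩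
  obtain ⟨m, rfl⟩ := Nat.exists_eq_add_of_le' hn
  refine (abs_lam_sub_le hγ0 hγ1 hβ hf m).trans ?_
  have hm : (0 : ℝ) < (m : ℝ) + 2 := by positivity
  rw [Real.div_rpow (by norm_num) hm.le, show -1 + γ = -(1 - γ) by ring]
  push_cast
  rw [Real.rpow_neg hm.le, div_eq_mul_inv, mul_right_comm]
  gcongr
  linarith

end PrefAttach

theorem mainTheorem3 (f : ℕ → ℝ) (hf0 : ∀ k, 0 ≤ f k) (γ : ℝ) (hγ : γ ∈ Set.Ioo (0 : ℝ) 1)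
    (hf : ∀ k : ℕ, f k ≤ γ * k + 1) :
    (∃ C : ℝ, 0 < C ∧ ∀ n : ℕ, 2 ≤ n →
      PrefAttach.tvDist (PrefAttach.outdegreeLaw f n).toMeasure
          (poissonMeasure (PrefAttach.lam f n).toNNReal)
        ≤ C * PrefAttach.outdegreeRate γ n) ∧
    IsProbabilityMeasure (PrefAttach.limitLaw f) ∧
    Integrable f (PrefAttach.limitLaw f) ∧
    Tendsto (PrefAttach.lam f) atTop (𝓝 (∫ k, f k ∂(PrefAttach.limitLaw f))) ∧
    (∀ β : ℝ, β ∈ Set.Icc (0 : ℝ) 1 → (∀ k : ℕ, f k = γ * k + β) →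
      ∃ C : ℝ, 0 < C ∧ ∀ n : ℕ, 2 ≤ n →
        |PrefAttach.lam f n - ∫ k, f k ∂(PrefAttach.limitLaw f)| ≤ C * (n : ℝ) ^ (-1 + γ)) :=
  ⟨PrefAttach.exists_tvDist_outdegreeLaw_le hf0 hγ.1 hγ.2 hf,
    PrefAttach.isProbabilityMeasure_limitLaw hf0 hγ.1.le hγ.2 hf,
    PrefAttach.integrable_limitLaw hf0 hγ.1.le hγ.2 hf,
    PrefAttach.tendsto_lam hf0 hγ.1.le hγ.2 hf,
    fun _ hβ hfβ => PrefAttach.exists_abs_lam_sub_integral_le hγ.1.le hγ.2 hβ hfβ⟩
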